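/- Let $V$ be either a (finite-dimensional) complex Lie group or a linear algebraic group over $\mathbb C$ (a Zariski closed subgroup of some $GL_n(\mathbb C)$), and let $G$ be a finite group acting on $V$ by holomorphic (respectively algebraic) group automorphisms. Let $\mathcal O$ be the sheaf of holomorphic (respectively regular) functions on $V$, with stalks $\mathcal O_x$. Let $\gimel\subset V$ be a $G$-invariant subgroup and let $v\in V$. *Skew-group ring.* For $\xi\in V$ put $\phi_\xi(f)=f\circ\xi^{-1}$, where $\xi$ also denotes left translation by $\xi$. Let $\mathcal S(\gimel)$ be the ring of finite sums $\sum_i f_i\phi_{\xi_i}$, with $f_i$ global meromorphic (respectively rational) functions on $V$ and $\xi_i\in\gimel$, with product $f\phi_\xi\circ f'\phi_{\xi'}=f\,\phi_\xi(f')\,\phi_{\xi\xi'}$. It acts on $\bigoplus_{x\in V}\mathcal M_x$, where $\mathcal M_x$ denotes the germs at $x$ of meromorphic (respectively rational) functions: $f\phi_\xi$ sends a germ $F$ at $x$ to the germ $f\cdot(F\circ\xi^{-1})$ at $\xi x$. Let $\mathcal B\subset\mathcal S(\gimel)$ be the algebra of all global $G$-invariant holomorphic (respectively regular) functions on $V$.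 *The modules.* Let $K\subset G$ be a subgroup and let $W\subset V$ be a $K$-invariant subset. Let $\mathfrak O^K|_W$ be the space of $K$-invariant elements of $\bigoplus_{x\in W}\mathcal O_x$. Let $\mathcal O_x^K\subset\mathcal O_x$ be the space of germs at $x$ that are components of $K$-invariant families of germs of functions along the orbit $K\cdot x$. Let $\mathcal J^K_e\subset\mathcal O_e$ be the ideal generated by the $K$-invariant germs at the identity $e$ that vanish at $e$. Put $$\mathbb E^K_\xi=\mathcal O^K_\xi/\bigl(\mathcal O^K_\xi\cap\phi_\xi(\mathcal J^K_e)\bigr),\qquad M(K,W)=\Bigl(\bigoplus_{\xi\in W}\mathbb E^K_\xi\Bigr)^K .$$ There is a natural map $\mathfrak O^K|_W\to M(K,W)$, given by taking classes. Write $\gimel\cdot v=\{\xi v:\xi\in\gimel\}$ and $(K\ltimes\gimel)\cdot v=\{\xi\,(g\cdot v):\xi\in\gimel,\ g\in K\}$, and let $K_{\gimel\cdot v}$ be the stabilizer in $K$ of the set $\gimel\cdot v$. **Proposition.** Let $H\subset G$ be a subgroup and let $\mathcal A\subset\mathcal S(\gimel)$ be a subalgebra with $\mathcal B\subset\mathcal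 A$ that preserves both $\mathfrak O^G|_{(G\ltimes\gimel)\cdot v}$ and $\mathfrak O^H|_{(H\ltimes\gimel)\cdot v}$. Then for each of the spaces $M(K,W)$ in the list $$M(G,(G\ltimes\gimel)\cdot v),\quad M(G_{\gimel\cdot v},\gimel\cdot v),\quad M(H,(H\ltimes\gimel)\cdot v),\quad M(H_{\gimel\cdot v},\gimel\cdot v)$$ the algebra $\mathcal A$ preserves $\mathfrak O^K|_W$ and its action there induces a unique $\mathcal A$-module structure on $M(K,W)$, and each of these $\mathcal A$-modules is a Harish-Chandra module: $\mathcal B$ acts on it locally finitely, i.e. every element lies in a finite-dimensional $\mathcal B$-invariant subspace. If, moreover, $\mathcal A$ preserves $\mathfrak O^H|_{(G\ltimes\gimel)\cdot v}$, then the same holds for $M(H,(G\ltimes\gimel)\cdot v)$. -/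

import Mathlib

open Filter Topology
open scoped Manifold ContDiff Pointwise

noncomputable section

namespace HarishChandra

/-! ### Germs of complex-valued functions along a filter -/

section Germs

variable {α β : Type*}

instance germAlgebra (l : Filter α) : Algebra ℂ (Germ l ℂ) :=
  Algebra.ofModule
    (fun r x y => by
      induction x using Filter.Germ.inductionOn with | _ x =>
      induction y using Filter.Germ.inductionOn with | _ y =>
      exact congrArg _ (smul_mul_assoc r x y))
    (fun r x y => by
      induction x using Filter.Germ.inductionOn with | _ x =>
      induction y using Filter.Germ.inductionOn with | _ y =>
      exact congrArg _ (mul_smul_comm r x y))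

/-- Pull-back of germs, `f ↦ f ∘ φ`. -/
def pull {l : Filter α} {l' : Filter β} (φ : β → α) (h : Tendsto φ l' l) :
    Germ l ℂ →ₐ[ℂ] Germ l' ℂ where
  toFun f := f.compTendsto φ h
  map_one' := rfl
  map_mul' x y := by
    induction x using Filter.Germ.inductionOn with | _ x =>
    induction y using Filter.Germ.inductionOn with | _ y => rfl
  map_zero' := rfl
  map_add' x y := by
    induction x using Filter.Germ.inductionOn with | _ x =>
    induction y using Filter.Germ.inductionOn with | _ y => rfl
  commutes' r := by
    rw [Algebra.algebraMap_eq_smul_one, Algebra.algebraMap_eq_smul_one]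
    rfl

@[simp] theorem pull_coe {l : Filter α} {l' : Filter β} (φ : β → α) (h : Tendsto φ l' l)
    (f : α → ℂ) : pull φ h (f : Germ l ℂ) = ((f ∘ φ : β → ℂ) : Germ l' ℂ) := rfl

/-- The filter of all sets that contain a dense open set. -/
def denselyOpen (t : TopologicalSpace α) : Filter α where
  sets := {s | ∃ D : Set α, IsOpen[t] D ∧ @Dense α t D ∧ D ⊆ s}
  univ_sets := ⟨Set.univ, isOpen_univ, dense_univ, subset_rfl⟩
  sets_of_superset := fun ⟨D, h1, h2, h3⟩ h => ⟨D, h1, h2, h3.trans h⟩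
  inter_sets := fun ⟨D, h1, h2, h3⟩ ⟨D', h1', h2', h3'⟩ =>
    ⟨D ∩ D', h1.inter h1', h2.inter_of_isOpen_left h2' h1, Set.inter_subset_inter h3 h3'⟩

end Germs

/-! ### Groups with a sheaf of functions -/

/-- A group `V` with a topology and a sheaf of complex-valued functions (given by its stalks:
`f` is a section over an open set `U` iff the germ of `f` at each point of `U` lies in the stalk),
such that the left translations and a group `G` of automorphisms of the group `V` act on it. -/
structure GeometricGroup (G V : Type*) [Group G] [Group V] [MulDistribMulAction G V] where
  top : TopologicalSpace V
  stalk (x : V) : Subalgebra ℂ (Germ (@nhds V top x) ℂ)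
  continuous_mul (ξ : V) : @Continuous V V top top (fun y => ξ * y)
  continuous_smul (g : G) : @Continuous V V top top (fun y => g • y)
  stalk_mul (ξ x : V) (f : V → ℂ) (hf : (f : Germ (@nhds V top (ξ * x)) ℂ) ∈ stalk (ξ * x)) :
    ((fun y => f (ξ * y) : V → ℂ) : Germ (@nhds V top x) ℂ) ∈ stalk x
  stalk_smul (g : G) (x : V) (f : V → ℂ)
      (hf : (f : Germ (@nhds V top (g • x)) ℂ) ∈ stalk (g • x)) :
    ((fun y => f (g • y) : V → ℂ) : Germ (@nhds V top x) ℂ) ∈ stalk x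

namespace GeometricGroup

variable {G V : Type*} [Group G] [Group V] [MulDistribMulAction G V] (X : GeometricGroup G V)

/-- The neighbourhood filter of `x`. -/
abbrev nhd (x : V) : Filter V := @nhds V X.top x

/-- Two functions on `V` are identified along this filter when they agree on a dense open set. -/
abbrev generic : Filter V := denselyOpen X.top

/-- Two functions are identified along this filter when they agree on a dense open subset of
a neighbourhood of `x`. -/
abbrev genericAt (x : V) : Filter V := X.generic ⊓ X.nhd x

theorem tendsto_mul_nhd (ξ : V) {x y : V} (h : ξ * x = y) :
    Tendsto (fun z => ξ * z) (X.nhd x) (X.nhd y) := by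
  subst h
  exact @Continuous.tendsto V V X.top X.top _ (X.continuous_mul ξ) x

theorem tendsto_smul_nhd (g : G) {x y : V} (h : g • x = y) :
    Tendsto (fun z => g • z) (X.nhd x) (X.nhd y) := by
  subst h
  exact @Continuous.tendsto V V X.top X.top _ (X.continuous_smul g) x

theorem tendsto_mul_generic (ξ : V) : Tendsto (fun z => ξ * z) X.generic X.generic := by
  let _ := X.top
  let e : V ≃ₜ V :=
    { toFun := fun y => ξ * y
      invFun := fun y => ξ⁻¹ * y
      left_inv := fun y => by simp
      right_inv := fun y => by simp
      continuous_toFun := X.continuous_mul ξ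
      continuous_invFun := X.continuous_mul ξ⁻¹ }
  rintro s ⟨D, h1, h2, h3⟩
  exact ⟨e ⁻¹' D, h1.preimage e.continuous, h2.preimage e.isOpenMap, fun y hy => h3 hy⟩

theorem tendsto_mul_genericAt (ξ : V) {x y : V} (h : ξ * x = y) :
    Tendsto (fun z => ξ * z) (X.genericAt x) (X.genericAt y) :=
  (X.tendsto_mul_generic ξ).inf (X.tendsto_mul_nhd ξ h)

theorem tendsto_id_generic (x : V) : Tendsto id (X.genericAt x) X.generic :=
  tendsto_id.mono_left inf_le_left

theorem tendsto_id_nhd (x : V) : Tendsto id (X.genericAt x) (X.nhd x) :=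
  tendsto_id.mono_left inf_le_right

/-- Pull-back `f ↦ f ∘ g` of germs along the action of `g`. -/
def smulPull (g : G) {x y : V} (h : g • x = y) : Germ (X.nhd y) ℂ →ₐ[ℂ] Germ (X.nhd x) ℂ :=
  pull (fun z => g • z) (X.tendsto_smul_nhd g h)

/-- Pull-back of germs along the left translation by `ξ`; this is the inverse of
`φ_ξ : f ↦ f ∘ ξ⁻¹`. -/
def mulPull (ξ : V) {x y : V} (h : ξ * x = y) : Germ (X.nhd y) ℂ →ₐ[ℂ] Germ (X.nhd x) ℂ :=
  pull (fun z => ξ * z) (X.tendsto_mul_nhd ξ h)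

/-- A germ at `x`, seen as a function defined generically near `x`. -/
def restrictGeneric (x : V) : Germ (X.nhd x) ℂ →ₐ[ℂ] Germ (X.genericAt x) ℂ :=
  pull id (X.tendsto_id_nhd x)

/-- The germ at `x` of a generically defined function. -/
def germAt (x : V) : Germ X.generic ℂ →ₐ[ℂ] Germ (X.genericAt x) ℂ :=
  pull id (X.tendsto_id_generic x)

theorem smulPull_mem (g : G) {x y : V} (h : g • x = y) {f : Germ (X.nhd y) ℂ}
    (hf : f ∈ X.stalk y) : X.smulPull g h f ∈ X.stalk x := by
  subst h
  induction f using Filter.Germ.inductionOn with | _ f => exact X.stalk_smul g x f hf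

theorem mulPull_mem (ξ : V) {x y : V} (h : ξ * x = y) {f : Germ (X.nhd y) ℂ}
    (hf : f ∈ X.stalk y) : X.mulPull ξ h f ∈ X.stalk x := by
  subst h
  induction f using Filter.Germ.inductionOn with | _ f => exact X.stalk_mul ξ x f hf

/-! ### Meromorphic (rational) functions and the skew-group ring -/

/-- The algebra of germs at `x` of meromorphic (rational) functions: quotients `p / q` of two germs
of the stalk, where `q` has no zero on a dense open subset of a neighbourhood of `x`. -/
def merStalk (x : V) : Subalgebra ℂ (Germ (X.genericAt x) ℂ) where
  carrier := {F | ∃ p ∈ X.stalk x, ∃ q ∈ X.stalk x,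
    IsUnit (X.restrictGeneric x q) ∧ X.restrictGeneric x q * F = X.restrictGeneric x p}
  mul_mem' := by
    rintro F F' ⟨p, hp, q, hq, hu, he⟩ ⟨p', hp', q', hq', hu', he'⟩
    refine ⟨p * p', mul_mem hp hp', q * q', mul_mem hq hq', ?_, ?_⟩
    · rw [map_mul]; exact hu.mul hu'
    · rw [map_mul, map_mul, ← he, ← he']; ring
  add_mem' := by
    rintro F F' ⟨p, hp, q, hq, hu, he⟩ ⟨p', hp', q', hq', hu', he'⟩
    refine ⟨p * q' + q * p', add_mem (mul_mem hp hq') (mul_mem hq hp'), q * q',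
      mul_mem hq hq', ?_, ?_⟩
    · rw [map_mul]; exact hu.mul hu'
    · rw [map_mul, map_add, map_mul, map_mul, ← he, ← he']; ring
  algebraMap_mem' r :=
    ⟨algebraMap ℂ _ r, Subalgebra.algebraMap_mem _ r, 1, one_mem _, by simp, by
      rw [map_one, one_mul, AlgHom.commutes]⟩

/-- Global meromorphic (rational) functions on `V`: functions on `V` modulo equality on a dense open
set which near each point are a quotient of two sections of the sheaf of functions. -/
def mer : Subalgebra ℂ (Germ X.generic ℂ) :=
  ⨅ x, (X.merStalk x).comap (X.germAt x)

theorem mem_mer {F : Germ X.generic ℂ} : F ∈ X.mer ↔ ∀ x, X.germAt x F ∈ X.merStalk x := by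
  simp [mer, Algebra.mem_iInf]

/-- `φ_ξ(f) = f ∘ ξ⁻¹` on generically defined functions. -/
def translate (ξ : V) : Germ X.generic ℂ →ₐ[ℂ] Germ X.generic ℂ :=
  pull (fun z => ξ⁻¹ * z) (X.tendsto_mul_generic ξ⁻¹)

theorem translate_mem (ξ : V) {F : Germ X.generic ℂ} (hF : F ∈ X.mer) :
    X.translate ξ F ∈ X.mer := by
  rw [mem_mer] at hF ⊢
  intro x
  obtain ⟨p, hp, q, hq, hu, he⟩ := hF (ξ⁻¹ * x)
  let T : Germ (X.genericAt (ξ⁻¹ * x)) ℂ →ₐ[ℂ] Germ (X.genericAt x) ℂ :=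
    pull (fun z => ξ⁻¹ * z) (X.tendsto_mul_genericAt ξ⁻¹ rfl)
  have h1 : ∀ r, T (X.restrictGeneric (ξ⁻¹ * x) r) =
      X.restrictGeneric x (X.mulPull ξ⁻¹ rfl r) := by
    intro r
    induction r using Filter.Germ.inductionOn with | _ r => rfl
  have h2 : T (X.germAt (ξ⁻¹ * x) F) = X.germAt x (X.translate ξ F) := by
    induction F using Filter.Germ.inductionOn with | _ F => rfl
  refine ⟨_, X.mulPull_mem ξ⁻¹ rfl hp, _, X.mulPull_mem ξ⁻¹ rfl hq, ?_, ?_⟩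
  · rw [← h1]; exact hu.map T
  · rw [← h1, ← h1, ← h2, ← map_mul, he]

/-- `V` acts on the meromorphic (rational) functions by `ξ • f = φ_ξ(f) = f ∘ ξ⁻¹`. -/
instance merAction : MulSemiringAction V X.mer where
  smul ξ f := ⟨X.translate ξ f.1, X.translate_mem ξ f.2⟩
  one_smul := by
    rintro ⟨F, hF⟩
    refine Subtype.ext (show X.translate 1 F = F from ?_)
    induction F using Filter.Germ.inductionOn with | _ F =>
    refine congrArg (fun h : V → ℂ => (h : Germ X.generic ℂ)) (funext fun z => ?_)
    simp
  mul_smul := by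
    rintro ξ η ⟨F, hF⟩
    refine Subtype.ext (show X.translate (ξ * η) F = X.translate ξ (X.translate η F) from ?_)
    induction F using Filter.Germ.inductionOn with | _ F =>
    refine congrArg (fun h : V → ℂ => (h : Germ X.generic ℂ)) (funext fun z => ?_)
    simp [mul_assoc]
  smul_zero ξ := Subtype.ext (map_zero (X.translate ξ))
  smul_add ξ a b := Subtype.ext (map_add (X.translate ξ) a.1 b.1)
  smul_one ξ := Subtype.ext (map_one (X.translate ξ))
  smul_mul ξ a b := Subtype.ext (map_mul (X.translate ξ) a.1 b.1)

instance merSMulComm (Γ : Subgroup V) : SMulCommClass Γ ℂ X.mer where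
  smul_comm ξ r a := Subtype.ext (map_smul (X.translate (ξ : V)) r a.1)

/-- The skew-group ring `𝒮(Γ)` of finite sums `∑ f_i φ_{ξ_i}` with meromorphic (rational) `f_i` and
`ξ_i ∈ Γ`, and multiplication `f φ_ξ ∘ f' φ_{ξ'} = f φ_ξ(f') φ_{ξ ξ'}`. -/
abbrev SkewRing (Γ : Subgroup V) : Type _ := SkewMonoidAlgebra X.mer Γ

/-- The action of the skew-group ring on families `F` of generically defined germs:
`f φ_ξ` sends the germ `F_x` to the germ `f · (F_x ∘ ξ⁻¹)` at `ξ x`. -/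
def act {Γ : Subgroup V} (a : X.SkewRing Γ) (F : ∀ x, Germ (X.genericAt x) ℂ) :
    ∀ x, Germ (X.genericAt x) ℂ := fun y =>
  a.sum fun ξ f => X.germAt y f.1 *
    pull (fun z => (ξ : V)⁻¹ * z) (X.tendsto_mul_genericAt (ξ : V)⁻¹ rfl) (F ((ξ : V)⁻¹ * y))

/-- The algebra of all global `G`-invariant sections of the sheaf of functions. -/
def globalInvariants : Subalgebra ℂ (V → ℂ) where
  carrier := {f | (∀ x, (f : Germ (X.nhd x) ℂ) ∈ X.stalk x) ∧ ∀ (g : G) (x : V), f (g • x) = f x}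
  mul_mem' := fun {f f'} h h' =>
    ⟨fun x => mul_mem (h.1 x) (h'.1 x), fun g x => by simp [h.2 g x, h'.2 g x]⟩
  add_mem' := fun {f f'} h h' =>
    ⟨fun x => add_mem (h.1 x) (h'.1 x), fun g x => by simp [h.2 g x, h'.2 g x]⟩
  algebraMap_mem' r := by
    refine ⟨fun x => ?_, fun g x => rfl⟩
    have h := Subalgebra.algebraMap_mem (X.stalk x) r
    rw [Algebra.algebraMap_eq_smul_one] at h
    rw [Algebra.algebraMap_eq_smul_one]
    exact h

/-- A global invariant function, seen as a meromorphic (rational) function. -/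
def globalToMer (f : X.globalInvariants) : X.mer :=
  ⟨((f : V → ℂ) : Germ X.generic ℂ), X.mem_mer.2 fun x =>
    ⟨_, f.2.1 x, 1, one_mem _, by simp, by rw [map_one, one_mul]; rfl⟩⟩

/-- The global `G`-invariant functions as a subalgebra `ℬ` of the skew-group ring. -/
def invariantFunctions (Γ : Subgroup V) : Subalgebra ℂ (X.SkewRing Γ) where
  carrier := Set.range fun f : X.globalInvariants =>
    (SkewMonoidAlgebra.single (1 : Γ) (X.globalToMer f) : X.SkewRing Γ)
  mul_mem' := by
    rintro _ _ ⟨f, rfl⟩ ⟨f', rfl⟩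
    refine ⟨f * f', ?_⟩
    simp only [SkewMonoidAlgebra.single_mul_single, one_smul, mul_one]
    rfl
  add_mem' := by
    rintro _ _ ⟨f, rfl⟩ ⟨f', rfl⟩
    refine ⟨f + f', ?_⟩
    simp only [← SkewMonoidAlgebra.single_add]
    rfl
  algebraMap_mem' r := by
    refine ⟨algebraMap ℂ _ r, ?_⟩
    rw [Algebra.algebraMap_eq_smul_one, Algebra.algebraMap_eq_smul_one,
      SkewMonoidAlgebra.one_def, SkewMonoidAlgebra.smul_single]
    rfl

/-! ### Invariant families of germs -/

section Invariants

variable (K : Subgroup G)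

/-- All `K`-invariant families of germs of functions (one germ at each point of `V`). -/
def invariantFamilies : Submodule ℂ (∀ x, Germ (X.nhd x) ℂ) where
  carrier := {F | (∀ x, F x ∈ X.stalk x) ∧ ∀ g ∈ K, ∀ x, X.smulPull g rfl (F (g • x)) = F x}
  add_mem' := fun {F F'} h h' =>
    ⟨fun x => add_mem (h.1 x) (h'.1 x), fun g hg x => by
      simp only [Pi.add_apply, map_add, h.2 g hg x, h'.2 g hg x]⟩
  zero_mem' := ⟨fun x => zero_mem _, fun g _ x => by simp⟩
  smul_mem' := fun r F h =>
    ⟨fun x => Subalgebra.smul_mem _ (h.1 x) r, fun g hg x => by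
      simp only [Pi.smul_apply, map_smul, h.2 g hg x]⟩

/-- `𝔒^K|_W`: the `K`-invariant elements of the direct sum of the stalks at the points of `W`. -/
def invariantSum (W : Set V) : Submodule ℂ (∀ x, Germ (X.nhd x) ℂ) where
  carrier := {F | F ∈ X.invariantFamilies K ∧ {x | F x ≠ 0}.Finite ∧ ∀ x ∉ W, F x = 0}
  add_mem' := fun {F F'} h h' =>
    ⟨add_mem h.1 h'.1, (h.2.1.union h'.2.1).subset fun x hx => by
      by_contra hn
      simp only [Set.mem_union, Set.mem_ofPred_eq, not_or, not_not] at hn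
      exact hx (by simp [hn.1, hn.2]), fun x hx => by simp [h.2.2 x hx, h'.2.2 x hx]⟩
  zero_mem' := ⟨zero_mem _, by simp, fun x _ => rfl⟩
  smul_mem' := fun r F h =>
    ⟨Submodule.smul_mem _ r h.1, h.2.1.subset fun x hx h0 => hx (by simp [h0]),
      fun x hx => by simp [h.2.2 x hx]⟩

/-- `𝒪^K_x`: the germs at `x` that extend to a `K`-invariant family of germs along the orbit. -/
def invariantStalk (x : V) : Submodule ℂ (Germ (X.nhd x) ℂ) :=
  (X.invariantFamilies K).map (LinearMap.proj x)

/-- The ideal `𝒥_e` of `𝒪_e` generated by the `K`-invariant germs that vanish at the identity. -/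
def augmentationIdeal : Ideal (X.stalk 1) :=
  Ideal.span {f | f.1 ∈ X.invariantStalk K 1 ∧ @Germ.value V ℂ X.top 1 f.1 = 0}

/-- `φ_ξ(𝒥_e)`, as the set of the germs `f` at `ξ` such that `f ∘ ξ` lies in `𝒥_e`. -/
def translatedIdeal (ξ : V) : Submodule ℂ (Germ (X.nhd ξ) ℂ) :=
  (((X.augmentationIdeal K).restrictScalars ℂ).map (X.stalk 1).val.toLinearMap).comap
    (X.mulPull ξ (mul_one ξ)).toLinearMap

/-- The fibre `𝔼_ξ = 𝒪^K_ξ / (𝒪^K_ξ ∩ φ_ξ(𝒥_e))`. -/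
abbrev Fibre (ξ : V) : Type _ :=
  X.invariantStalk K ξ ⧸ (X.translatedIdeal K ξ).submoduleOf (X.invariantStalk K ξ)

variable {K}

theorem smulPull_mem_invariantStalk {g : G} (hg : g ∈ K) (x : V) {f : Germ (X.nhd (g • x)) ℂ}
    (hf : f ∈ X.invariantStalk K (g • x)) : X.smulPull g rfl f ∈ X.invariantStalk K x := by
  obtain ⟨F, hF, rfl⟩ := hf
  exact ⟨F, hF, (hF.2 g hg x).symm⟩

theorem smulPull_mem_translatedIdeal {g : G} (hg : g ∈ K) (x : V) {f : Germ (X.nhd (g • x)) ℂ}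
    (hf : f ∈ X.translatedIdeal K (g • x)) : X.smulPull g rfl f ∈ X.translatedIdeal K x := by
  obtain ⟨j, hj, he⟩ := hf
  let T : X.stalk 1 →+* X.stalk 1 :=
    { toFun := fun a => ⟨X.smulPull g (smul_one g) a.1, X.smulPull_mem g (smul_one g) a.2⟩
      map_one' := Subtype.ext (map_one _)
      map_mul' := fun a b => Subtype.ext (map_mul _ _ _)
      map_zero' := Subtype.ext (map_zero _)
      map_add' := fun a b => Subtype.ext (map_add _ _ _) }
  have hT : X.augmentationIdeal K ≤ (X.augmentationIdeal K).comap T := by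
    refine Ideal.span_le.2 ?_
    rintro a ⟨⟨F, hF, ha⟩, h0⟩
    have h1 : X.smulPull g (smul_one g) a.1 = a.1 := by
      rw [← ha]
      have key : ∀ y (h : g • (1 : V) = y), X.smulPull g h (F y) = F 1 := by
        rintro y rfl
        exact hF.2 g hg 1
      exact key 1 (smul_one g)
    have h2 : T a = a := Subtype.ext h1
    show T a ∈ X.augmentationIdeal K
    rw [h2]
    exact Ideal.subset_span ⟨⟨F, hF, ha⟩, h0⟩
  refine ⟨T j, hT hj, ?_⟩
  show X.smulPull g (smul_one g) j.1 = X.mulPull x (mul_one x) (X.smulPull g rfl f)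
  have he' : j.1 = X.mulPull (g • x) (mul_one (g • x)) f := he
  rw [he']
  induction f using Filter.Germ.inductionOn with | _ f =>
  refine congrArg (fun h : V → ℂ => (h : Germ (X.nhd 1) ℂ)) (funext fun z => ?_)
  simp [smul_mul']

/-- The pull-back `𝔼_{g x} → 𝔼_x` along `g`. -/
def fibrePull {g : G} (hg : g ∈ K) (x : V) : X.Fibre K (g • x) →ₗ[ℂ] X.Fibre K x :=
  Submodule.mapQ _ _
    ((X.smulPull g (rfl : g • x = g • x)).toLinearMap.restrict
      fun _ hf => X.smulPull_mem_invariantStalk hg x hf)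
    fun _ hf => X.smulPull_mem_translatedIdeal hg x hf

variable (K)

/-- `M(K, W) = 𝔈^K|_W`: the `K`-invariant elements of the direct sum of the fibres `𝔼_ξ` over the
points `ξ` of `W`. -/
def M (W : Set V) : Submodule ℂ (∀ ξ, X.Fibre K ξ) where
  carrier := {c | {ξ | c ξ ≠ 0}.Finite ∧ (∀ ξ ∉ W, c ξ = 0) ∧
    ∀ (g : G) (hg : g ∈ K) (ξ : V), X.fibrePull hg ξ (c (g • ξ)) = c ξ}
  add_mem' := fun {c c'} h h' =>
    ⟨(h.1.union h'.1).subset fun x hx => by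
      by_contra hn
      simp only [Set.mem_union, Set.mem_ofPred_eq, not_or, not_not] at hn
      exact hx (by simp [hn.1, hn.2]), fun x hx => by simp [h.2.1 x hx, h'.2.1 x hx],
      fun g hg x => by simp only [Pi.add_apply, map_add, h.2.2 g hg x, h'.2.2 g hg x]⟩
  zero_mem' := ⟨by simp, fun _ _ => rfl, fun g hg x => by simp⟩
  smul_mem' := fun r c h =>
    ⟨h.1.subset fun x hx h0 => hx (by simp [h0]), fun x hx => by simp [h.2.1 x hx],
      fun g hg x => by simp only [Pi.smul_apply, map_smul, h.2.2 g hg x]⟩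

variable {K}

theorem mem_invariantStalk {W : Set V} {F : ∀ x, Germ (X.nhd x) ℂ} (hF : F ∈ X.invariantSum K W)
    (x : V) : F x ∈ X.invariantStalk K x := ⟨F, hF.1, rfl⟩

variable (K)

/-- The map `𝔒^K|_W → M(K, W)` that sends an invariant family of germs to its classes. -/
def toM (W : Set V) : X.invariantSum K W →ₗ[ℂ] X.M K W where
  toFun F := ⟨fun ξ => Submodule.Quotient.mk ⟨F.1 ξ, X.mem_invariantStalk F.2 ξ⟩, by
    refine ⟨F.2.2.1.subset fun ξ hξ h0 => hξ ?_, fun ξ hξ => ?_, fun g hg ξ => ?_⟩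
    · exact (congrArg Submodule.Quotient.mk (Subtype.ext h0)).trans (Submodule.Quotient.mk_zero _)
    · exact (congrArg Submodule.Quotient.mk (Subtype.ext (F.2.2.2 ξ hξ))).trans
        (Submodule.Quotient.mk_zero _)
    · exact congrArg Submodule.Quotient.mk (Subtype.ext (F.2.1.2 g hg ξ))⟩
  map_add' _ _ := rfl
  map_smul' _ _ := rfl

end Invariants

/-! ### The modules -/

section Modules

variable {X} {Γ : Subgroup V}

/-- `a F = F'` for an element `a` of the skew-group ring and families `F`, `F'` of germs of
functions. -/
def ActsTo (a : X.SkewRing Γ) (F F' : ∀ x, Germ (X.nhd x) ℂ) : Prop :=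
  X.act a (fun x => X.restrictGeneric x (F x)) = fun x => X.restrictGeneric x (F' x)

/-- The algebra `A` preserves the vector space `𝔒^K|_W`. -/
def Preserves (A : Subalgebra ℂ (X.SkewRing Γ)) (K : Subgroup G) (W : Set V) : Prop :=
  ∀ a ∈ A, ∀ F ∈ X.invariantSum K W, ∃ F' ∈ X.invariantSum K W, ActsTo a F F'

/-- The `A`-module structure `ρ` on `M(K, W)` is induced by the action of `A` on `𝔒^K|_W`. -/
def IsInduced (A : Subalgebra ℂ (X.SkewRing Γ)) (K : Subgroup G) (W : Set V)
    (ρ : A →ₐ[ℂ] Module.End ℂ (X.M K W)) : Prop :=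
  ∀ (a : A) (F F' : X.invariantSum K W), ActsTo a.1 F.1 F'.1 →
    ρ a (X.toM K W F) = X.toM K W F'

/-- An `A`-module is a Harish-Chandra module if the algebra `ℬ` of global `G`-invariant functions
acts locally finitely: every element lies in a finite-dimensional `ℬ`-invariant subspace. -/
def IsHarishChandra (A : Subalgebra ℂ (X.SkewRing Γ)) {N : Type*} [AddCommMonoid N] [Module ℂ N]
    (ρ : A →ₐ[ℂ] Module.End ℂ N) : Prop :=
  ∀ m : N, ∃ L : Submodule ℂ N, m ∈ L ∧ Module.Finite ℂ L ∧
    ∀ b : A, b.1 ∈ X.invariantFunctions Γ → ∀ l ∈ L, ρ b l ∈ L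

/-- `A` preserves `𝔒^K|_W`, its action there induces one and only one `A`-module structure on
`M(K, W)`, and this `A`-module is a Harish-Chandra module. -/
def MIsHarishChandra (A : Subalgebra ℂ (X.SkewRing Γ)) (K : Subgroup G) (W : Set V) : Prop :=
  Preserves A K W ∧ ∃ ρ : A →ₐ[ℂ] Module.End ℂ (X.M K W),
    IsInduced A K W ρ ∧ (∀ ρ', IsInduced A K W ρ' → ρ' = ρ) ∧ IsHarishChandra A ρ

end Modules

end GeometricGroup

/-- The orbit `(K ⋉ Γ) · v`. -/
def bigOrbit {G V : Type*} [Group G] [Group V] [MulDistribMulAction G V] (K : Subgroup G)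
    (Γ : Subgroup V) (v : V) : Set V :=
  {x | ∃ ξ ∈ Γ, ∃ g ∈ K, x = ξ * g • v}

/-- The orbit `Γ · v` of the left translations by elements of `Γ`. -/
def smallOrbit {V : Type*} [Group V] (Γ : Subgroup V) (v : V) : Set V :=
  {x | ∃ ξ ∈ Γ, x = ξ * v}

/-- The stabilizer in `K` of the set `Γ · v`. -/
def orbitStabilizer {G V : Type*} [Group G] [Group V] [MulDistribMulAction G V] (K : Subgroup G)
    (Γ : Subgroup V) (v : V) : Subgroup G :=
  K ⊓ MulAction.stabilizer G (smallOrbit Γ v)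

/-! ### Complex Lie groups -/

section Analytic

variable {V E : Type*} [NormedAddCommGroup E] [NormedSpace ℂ E] [TopologicalSpace V]
  [ChartedSpace E V]

/-- Germs at `x` of holomorphic functions. -/
def holStalk (E : Type*) {V : Type*} [NormedAddCommGroup E] [NormedSpace ℂ E]
    [TopologicalSpace V] [ChartedSpace E V] (x : V) : Subalgebra ℂ (Germ (𝓝 x) ℂ) where
  carrier := {F | ∃ f : V → ℂ, F = f ∧ ∀ᶠ y in 𝓝 x, ContMDiffAt 𝓘(ℂ, E) 𝓘(ℂ, ℂ) ω f y}
  mul_mem' := by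
    rintro _ _ ⟨f, rfl, hf⟩ ⟨f', rfl, hf'⟩
    exact ⟨f * f', rfl, by filter_upwards [hf, hf'] with y h h' using h.mul h'⟩
  add_mem' := by
    rintro _ _ ⟨f, rfl, hf⟩ ⟨f', rfl, hf'⟩
    exact ⟨f + f', rfl, by filter_upwards [hf, hf'] with y h h' using h.add h'⟩
  algebraMap_mem' r := by
    refine ⟨fun _ => r, ?_, Eventually.of_forall fun y => contMDiffAt_const⟩
    rw [Algebra.algebraMap_eq_smul_one]
    refine congrArg (fun h : V → ℂ => (h : Germ (𝓝 x) ℂ)) (funext fun z => ?_)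
    simp

theorem comp_mem_holStalk {φ : V → V} (hφ : ContMDiff 𝓘(ℂ, E) 𝓘(ℂ, E) ω φ) (x : V) (f : V → ℂ)
    (hf : (f : Germ (𝓝 (φ x)) ℂ) ∈ holStalk E (φ x)) :
    ((fun y => f (φ y) : V → ℂ) : Germ (𝓝 x) ℂ) ∈ holStalk E x := by
  obtain ⟨f', he, h⟩ := hf
  refine ⟨fun y => f' (φ y), ?_, ?_⟩
  · exact Germ.coe_eq.2 (hφ.continuous.continuousAt.eventually (Germ.coe_eq.1 he))
  · filter_upwards [hφ.continuous.continuousAt.eventually h] with y hy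
    exact ContMDiffAt.comp y hy (hφ y)

/-- A complex Lie group `V` with a group `G` acting on it by holomorphic automorphisms. -/
def complexLieGroup {G : Type*} [Group G] [Group V] [MulDistribMulAction G V]
    [LieGroup 𝓘(ℂ, E) ω V]
    (hG : ∀ g : G, ContMDiff 𝓘(ℂ, E) 𝓘(ℂ, E) ω (fun y : V => g • y)) : GeometricGroup G V where
  top := inferInstance
  stalk x := holStalk E x
  continuous_mul ξ := (contMDiff_mul_left (I := 𝓘(ℂ, E)) (n := ω) (a := ξ)).continuous
  continuous_smul g := (hG g).continuous
  stalk_mul ξ x f hf := comp_mem_holStalk (contMDiff_mul_left (a := ξ)) x f hf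
  stalk_smul g x f hf := comp_mem_holStalk (hG g) x f hf

end Analytic

/-! ### Linear algebraic groups -/

section Algebraic

variable {n : ℕ} (V : Subgroup (Matrix.GeneralLinearGroup (Fin n) ℂ))

/-- The value at `x ∈ V` of a polynomial in the matrix entries. -/
def evalAt (p : MvPolynomial (Fin n × Fin n) ℂ) (x : V) : ℂ :=
  MvPolynomial.eval (fun ij => x.1.1 ij.1 ij.2) p

/-- `V` is a linear algebraic group: a Zariski closed subgroup of `GL_n(ℂ)`. -/
def IsZariskiClosed : Prop :=
  ∃ S : Set (MvPolynomial (Fin n × Fin n) ℂ), ∀ x : Matrix.GeneralLinearGroup (Fin n) ℂ,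
    x ∈ V ↔ ∀ p ∈ S, MvPolynomial.eval (fun ij => x.1 ij.1 ij.2) p = 0

/-- The Zariski topology on `V`. -/
@[reducible]
def zariski : TopologicalSpace V :=
  TopologicalSpace.generateFrom (Set.range fun p => {x : V | evalAt V p x ≠ 0})

theorem isOpen_evalAt (p : MvPolynomial (Fin n × Fin n) ℂ) :
    IsOpen[zariski V] {x : V | evalAt V p x ≠ 0} :=
  TopologicalSpace.isOpen_generateFrom_of_mem ⟨p, rfl⟩

theorem eventually_evalAt {q : MvPolynomial (Fin n × Fin n) ℂ} {x : V} (h : evalAt V q x ≠ 0) :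
    ∀ᶠ y in @nhds V (zariski V) x, evalAt V q y ≠ 0 :=
  @IsOpen.mem_nhds V (zariski V) x _ (isOpen_evalAt V q) h

/-- `f` is regular at `x`: near `x` it is a quotient of polynomials whose denominator does not
vanish at `x`. -/
def IsRegularAt (f : V → ℂ) (x : V) : Prop :=
  ∃ p q : MvPolynomial (Fin n × Fin n) ℂ, evalAt V q x ≠ 0 ∧
    ∀ᶠ y in @nhds V (zariski V) x, f y = evalAt V p y / evalAt V q y

/-- Germs at `x`, for the Zariski topology, of regular functions. -/
def regStalk (x : V) : Subalgebra ℂ (Germ (@nhds V (zariski V) x) ℂ) where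
  carrier := {F | ∃ f : V → ℂ, F = f ∧ IsRegularAt V f x}
  mul_mem' := by
    rintro _ _ ⟨f, rfl, p, q, hq, hf⟩ ⟨f', rfl, p', q', hq', hf'⟩
    refine ⟨f * f', rfl, p * p', q * q', ?_, ?_⟩
    · simp only [evalAt, map_mul] at *
      exact mul_ne_zero hq hq'
    · filter_upwards [hf, hf'] with y h h'
      simp only [evalAt, map_mul, Pi.mul_apply] at *
      rw [h, h', div_mul_div_comm]
  add_mem' := by
    rintro _ _ ⟨f, rfl, p, q, hq, hf⟩ ⟨f', rfl, p', q', hq', hf'⟩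
    refine ⟨f + f', rfl, p * q' + q * p', q * q', ?_, ?_⟩
    · simp only [evalAt, map_mul] at *
      exact mul_ne_zero hq hq'
    · filter_upwards [hf, hf', eventually_evalAt V hq, eventually_evalAt V hq'] with y h h' h1 h2
      simp only [evalAt, map_mul, map_add, Pi.add_apply] at *
      rw [h, h', div_add_div _ _ h1 h2]
  algebraMap_mem' r := by
    refine ⟨fun _ => r, ?_, MvPolynomial.C r, 1, by simp [evalAt],
      Eventually.of_forall fun y => by simp [evalAt]⟩
    rw [Algebra.algebraMap_eq_smul_one]
    refine congrArg (fun h : V → ℂ => (h : Germ (@nhds V (zariski V) x) ℂ)) (funext fun z => ?_)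
    simp

theorem coe_mem_regStalk {f : V → ℂ} {x : V} :
    (f : Germ (@nhds V (zariski V) x) ℂ) ∈ regStalk V x ↔ IsRegularAt V f x := by
  constructor
  · rintro ⟨f', he, p, q, hq, h⟩
    refine ⟨p, q, hq, ?_⟩
    filter_upwards [Germ.coe_eq.1 he, h] with y h1 h2
    exact h1.trans h2
  · exact fun h => ⟨f, rfl, h⟩

/-- A regular map (morphism of varieties) `V → V`: all matrix entries are regular functions. -/
def IsRegularMap (φ : V → V) : Prop :=
  ∀ i j, ∀ x, IsRegularAt V (fun y => (φ y).1.1 i j) x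

variable {V}

theorem IsRegularMap.evalAt_comp {φ : V → V} (hφ : IsRegularMap V φ)
    (p : MvPolynomial (Fin n × Fin n) ℂ) (x : V) : IsRegularAt V (fun y => evalAt V p (φ y)) x := by
  rw [← coe_mem_regStalk]
  induction p using MvPolynomial.induction_on with
  | C a =>
    refine coe_mem_regStalk V |>.2 ⟨MvPolynomial.C a, 1, by simp [evalAt],
      Eventually.of_forall fun y => by simp [evalAt]⟩
  | add p q hp hq =>
    have := add_mem hp hq
    refine (congrArg (· ∈ regStalk V x) ?_).mp this
    refine congrArg (fun h : V → ℂ => (h : Germ (@nhds V (zariski V) x) ℂ)) (funext fun z => ?_)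
    simp [evalAt]
  | mul_X p ij hp =>
    have := mul_mem hp ((coe_mem_regStalk V).2 (hφ ij.1 ij.2 x))
    refine (congrArg (· ∈ regStalk V x) ?_).mp this
    refine congrArg (fun h : V → ℂ => (h : Germ (@nhds V (zariski V) x) ℂ)) (funext fun z => ?_)
    simp [evalAt]

theorem IsRegularMap.continuous {φ : V → V} (hφ : IsRegularMap V φ) :
    @Continuous V V (zariski V) (zariski V) φ := by
  let _ := zariski V
  refine continuous_generateFrom_iff.2 ?_
  rintro _ ⟨p, rfl⟩
  refine isOpen_iff_mem_nhds.2 fun x hx => ?_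
  obtain ⟨a, b, hb, h⟩ := hφ.evalAt_comp p x
  have hx' : evalAt V p (φ x) ≠ 0 := hx
  have hs : evalAt V p (φ x) = evalAt V a x / evalAt V b x := h.self_of_nhds
  have ha : evalAt V a x ≠ 0 := fun h0 => hx' (by rw [hs, h0, zero_div])
  filter_upwards [h, eventually_evalAt V ha, eventually_evalAt V hb] with y h1 h2 h3
  show evalAt V p (φ y) ≠ 0
  rw [h1]
  exact div_ne_zero h2 h3

theorem IsRegularMap.comp_mem {φ : V → V} (hφ : IsRegularMap V φ) (x : V) (f : V → ℂ)
    (hf : (f : Germ (@nhds V (zariski V) (φ x)) ℂ) ∈ regStalk V (φ x)) :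
    ((fun y => f (φ y) : V → ℂ) : Germ (@nhds V (zariski V) x) ℂ) ∈ regStalk V x := by
  let _ := zariski V
  rw [coe_mem_regStalk] at hf ⊢
  obtain ⟨p, q, hq, h⟩ := hf
  obtain ⟨a, b, hb, h1⟩ := hφ.evalAt_comp p x
  obtain ⟨c, d, hd, h2⟩ := hφ.evalAt_comp q x
  have hs : evalAt V q (φ x) = evalAt V c x / evalAt V d x := h2.self_of_nhds
  have hc : evalAt V c x ≠ 0 := fun h0 => hq (by rw [hs, h0, zero_div])
  refine ⟨a * d, b * c, ?_, ?_⟩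
  · simp only [evalAt, map_mul] at *
    exact mul_ne_zero hb hc
  · filter_upwards [hφ.continuous.continuousAt.eventually h, h1, h2] with y h3 h4 h5
    simp only [evalAt, map_mul] at *
    rw [h3, h4, h5, div_div_div_eq]

theorem isRegularMap_mul (ξ : V) : IsRegularMap V (fun y => ξ * y) := by
  intro i j x
  refine ⟨∑ k, MvPolynomial.C (ξ.1.1 i k) * MvPolynomial.X (k, j), 1, by simp [evalAt],
    Eventually.of_forall fun y => ?_⟩
  simp [evalAt, Matrix.mul_apply]

/-- A linear algebraic group `V` with a group `G` acting on it by algebraic automorphisms. -/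
def linearAlgebraicGroup {G : Type*} [Group G] [MulDistribMulAction G V]
    (hG : ∀ g : G, IsRegularMap V (fun y => g • y)) : GeometricGroup G V where
  top := zariski V
  stalk x := regStalk V x
  continuous_mul ξ := (isRegularMap_mul ξ).continuous
  continuous_smul g := (hG g).continuous
  stalk_mul ξ x f hf := (isRegularMap_mul ξ).comp_mem x f hf
  stalk_smul g x f hf := (hG g).comp_mem x f hf

end Algebraic

end HarishChandra

end

open HarishChandra HarishChandra.GeometricGroup

/-! A skew-group element acts on families of germs through translations and multiplications, so its
action commutes with multiplication by any translation-invariant family, in particular by the family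
τ_h of all translates of one germ h at the identity (`ActsTo.translates_mul`). This is what lets the
action descend to M(K, W).

Averaging over the finite group K gives a Reynolds operator. It shows that 𝔒^K|_W maps onto M(K, W)
when W is K-stable (`toM_surjective`), and that the kernel of this map is contained in the span of
the products τ_h · R, with h a K-invariant germ vanishing at e and R in 𝔒^K|_W (`mem_kernelSpan`).
For a in A one has a(τ_h R) = τ_h · (aR), and aR is again in 𝔒^K|_W, so A preserves the kernel. The
image family is unique because a germ of a function is determined on a dense open set. Hence A acts
on the quotient, and surjectivity makes the action unique.

For a small orbit Γv, an invariant family under the stabilizer of Γv extends to a K-invariant family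
on the big orbit by a rescaled average. Applying a there and restricting back to Γv proves
preservation, since an element of 𝒮(Γ) never mixes different Γ-orbits.

Local finiteness: an invariant global function acts by pointwise multiplication and does not enlarge
supports, so it suffices that each fibre is finite-dimensional. Each germ f vanishing at e is a root
of ∏_g (T - g·f), whose non-leading coefficients are K-invariant and vanish at e; thus f^|K| lies in
𝒥_e. As the maximal ideal at e is finitely generated (Hadamard's lemma in the analytic case,
polynomial expansion in the algebraic one), 𝒥_e has finite codimension. -/

noncomputable section

namespace HarishChandra

namespace GeometricGroup

/-! ### The action of the skew-group ring on families of germs -/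

section Action

variable {G V : Type*} [Group G] [Group V] [MulDistribMulAction G V] {X : GeometricGroup G V}
  {Γ : Subgroup V}

/-- `φ_ξ` on generically defined germs. -/
def translateGerm (X : GeometricGroup G V) (ξ y : V) :
    Germ (X.genericAt (ξ⁻¹ * y)) ℂ →ₐ[ℂ] Germ (X.genericAt y) ℂ :=
  pull (fun z => ξ⁻¹ * z) (X.tendsto_mul_genericAt ξ⁻¹ rfl)

theorem act_single (ξ : Γ) (f : X.mer) (F : ∀ x, Germ (X.genericAt x) ℂ) (y : V) :
    X.act (SkewMonoidAlgebra.single ξ f : X.SkewRing Γ) F y =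
      X.germAt y f.1 * X.translateGerm ξ y (F ((ξ : V)⁻¹ * y)) := by
  unfold act
  rw [SkewMonoidAlgebra.sum_single_index]
  · rfl
  · simp

theorem act_add_left (a b : X.SkewRing Γ) (F : ∀ x, Germ (X.genericAt x) ℂ) :
    X.act (a + b) F = X.act a F + X.act b F := by
  funext y
  refine SkewMonoidAlgebra.sum_add_index' (fun ξ => ?_) fun ξ f f' => ?_
  · simp
  · simp [add_mul]

theorem act_zero_left (F : ∀ x, Germ (X.genericAt x) ℂ) :
    X.act (0 : X.SkewRing Γ) F = 0 := by
  funext y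
  exact SkewMonoidAlgebra.sum_zero_index

theorem act_add (a : X.SkewRing Γ) (F F' : ∀ x, Germ (X.genericAt x) ℂ) :
    X.act a (F + F') = X.act a F + X.act a F' := by
  induction a using SkewMonoidAlgebra.induction_on with
  | zero =>
    simp [act_zero_left]
  | single ξ f =>
    funext y
    simp only [Pi.add_apply, act_single, map_add, mul_add]
  | add a b ha hb =>
    rw [act_add_left, act_add_left, act_add_left, ha, hb]; abel

theorem act_smul (a : X.SkewRing Γ) (r : ℂ) (F : ∀ x, Germ (X.genericAt x) ℂ) :
    X.act a (r • F) = r • X.act a F := by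
  induction a using SkewMonoidAlgebra.induction_on with
  | zero =>
    simp [act_zero_left]
  | single ξ f =>
    funext y
    simp only [Pi.smul_apply, act_single, map_smul, mul_smul_comm]
  | add a b ha hb =>
    rw [act_add_left, act_add_left, ha, hb, smul_add]

theorem act_smul_left (r : ℂ) (a : X.SkewRing Γ) (F : ∀ x, Germ (X.genericAt x) ℂ) :
    X.act (r • a) F = r • X.act a F := by
  induction a using SkewMonoidAlgebra.induction_on with
  | zero =>
    simp [act_zero_left]
  | single ξ f =>
    funext y
    rw [SkewMonoidAlgebra.smul_single]
    simp only [Pi.smul_apply, act_single, Subalgebra.coe_smul, map_smul, smul_mul_assoc]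
  | add a b ha hb =>
    rw [smul_add, act_add_left, act_add_left, ha, hb, smul_add]

theorem act_one (F : ∀ x, Germ (X.genericAt x) ℂ) : X.act (1 : X.SkewRing Γ) F = F := by
  funext y
  rw [SkewMonoidAlgebra.one_def, act_single]
  -- The germ at `1⁻¹ * y` and the germ at `y` have different types; making the base point a
  -- variable allows the two points to be identified.
  have key : ∀ x (h : (1 : V)⁻¹ * y = x),
      pull (fun z => (1 : V)⁻¹ * z) (X.tendsto_mul_genericAt (1 : V)⁻¹ h) (F x) = F y := by
    intro x h
    obtain rfl : y = x := by simpa using h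
    induction F y using Filter.Germ.inductionOn with | _ f =>
    refine congrArg (fun h : V → ℂ => (h : Germ (X.genericAt y) ℂ)) (funext fun z => ?_)
    simp
  rw [OneMemClass.coe_one, map_one, one_mul]
  exact key _ rfl

theorem translateGerm_translateGerm (ξ η y : V) (F : ∀ x, Germ (X.genericAt x) ℂ) :
    X.translateGerm ξ y (X.translateGerm η (ξ⁻¹ * y) (F (η⁻¹ * (ξ⁻¹ * y)))) =
      X.translateGerm (ξ * η) y (F ((ξ * η)⁻¹ * y)) := by
  have key : ∀ x x' (h : η⁻¹ * (ξ⁻¹ * y) = x) (h' : (ξ * η)⁻¹ * y = x'), x = x' →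
      X.translateGerm ξ y (pull (fun z => η⁻¹ * z) (X.tendsto_mul_genericAt η⁻¹ h) (F x)) =
      pull (fun z => (ξ * η)⁻¹ * z) (X.tendsto_mul_genericAt (ξ * η)⁻¹ h') (F x') := by
    rintro x _ h h' rfl
    induction F x using Filter.Germ.inductionOn with | _ f =>
    refine congrArg (fun h : V → ℂ => (h : Germ (X.genericAt y) ℂ)) (funext fun z => ?_)
    simp [mul_assoc]
  exact key _ _ rfl rfl (by group)

theorem translateGerm_germAt (ξ y : V) (f : X.mer) :
    X.translateGerm ξ y (X.germAt (ξ⁻¹ * y) f.1) = X.germAt y (ξ • f).1 := by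
  obtain ⟨f, hf⟩ := f
  induction f using Filter.Germ.inductionOn with | _ f => rfl

theorem act_mul (a b : X.SkewRing Γ) (F : ∀ x, Germ (X.genericAt x) ℂ) :
    X.act (a * b) F = X.act a (X.act b F) := by
  induction a using SkewMonoidAlgebra.induction_on with
  | zero =>
    simp [act_zero_left]
  | single ξ f =>
    induction b using SkewMonoidAlgebra.induction_on with
    | zero =>
      rw [mul_zero, act_zero_left]
      funext y
      simp [act_single]
    | single η f' =>
      funext y
      rw [SkewMonoidAlgebra.single_mul_single, act_single, act_single, act_single, map_mul,
        translateGerm_translateGerm, translateGerm_germAt, ← mul_assoc, ← map_mul]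
      rfl
    | add b b' hb hb' =>
      rw [mul_add, act_add_left, act_add_left, act_add, hb, hb']
  | add a a' ha hb =>
    rw [add_mul, act_add_left, act_add_left, ha, hb]

/-- The action commutes with the multiplication by families that are invariant under the
translations by elements of `Γ`. -/
theorem act_mul_right (a : X.SkewRing Γ) {H : ∀ x, Germ (X.genericAt x) ℂ}
    (hH : ∀ (ξ : Γ) y, X.translateGerm ξ y (H ((ξ : V)⁻¹ * y)) = H y)
    (F : ∀ x, Germ (X.genericAt x) ℂ) : X.act a (H * F) = H * X.act a F := by
  induction a using SkewMonoidAlgebra.induction_on with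
  | zero =>
    simp [act_zero_left]
  | single ξ f =>
    funext y
    simp only [Pi.mul_apply, act_single, map_mul, hH]
    ring
  | add a b ha hb =>
    rw [act_add_left, act_add_left, ha, hb, mul_add]

/-- The value of `a F` at `y` depends only on the restriction of `F` to `Γ y`. -/
theorem act_congr (a : X.SkewRing Γ) {F F' : ∀ x, Germ (X.genericAt x) ℂ} {y : V}
    (h : ∀ ξ ∈ Γ, F (ξ * y) = F' (ξ * y)) : X.act a F y = X.act a F' y := by
  induction a using SkewMonoidAlgebra.induction_on with
  | zero =>
    simp [act_zero_left]
  | single ξ f =>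
    rw [act_single, act_single, h _ (inv_mem ξ.2)]
  | add a b ha hb =>
    rw [act_add_left, act_add_left, Pi.add_apply, Pi.add_apply, ha, hb]

theorem ActsTo.add {a : X.SkewRing Γ} {F F' E E' : ∀ x, Germ (X.nhd x) ℂ}
    (h : ActsTo a F F') (h' : ActsTo a E E') : ActsTo a (F + E) (F' + E') := by
  have := act_add a (fun x => X.restrictGeneric x (F x)) fun x => X.restrictGeneric x (E x)
  unfold ActsTo at *
  rw [h, h'] at this
  convert this using 2
  · funext x; simp
  · simp

theorem ActsTo.smul {a : X.SkewRing Γ} {F F' : ∀ x, Germ (X.nhd x) ℂ} (r : ℂ)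
    (h : ActsTo a F F') : ActsTo a (r • F) (r • F') := by
  have := act_smul a r (fun x => X.restrictGeneric x (F x))
  unfold ActsTo at *
  rw [h] at this
  convert this using 2
  · funext x; simp
  · simp

theorem ActsTo.zero (a : X.SkewRing Γ) : ActsTo a (0 : ∀ x, Germ (X.nhd x) ℂ) 0 := by
  have := act_smul a 0 (fun x => X.restrictGeneric x (0 : Germ (X.nhd x) ℂ))
  rw [zero_smul, zero_smul] at this
  unfold ActsTo
  convert this using 2
  · funext x; simp
  · simp

theorem ActsTo.add_left {a b : X.SkewRing Γ} {F F' F'' : ∀ x, Germ (X.nhd x) ℂ}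
    (h : ActsTo a F F') (h' : ActsTo b F F'') : ActsTo (a + b) F (F' + F'') := by
  unfold ActsTo at *
  rw [act_add_left, h, h']
  funext x
  simp

theorem ActsTo.smul_left {a : X.SkewRing Γ} {F F' : ∀ x, Germ (X.nhd x) ℂ} (r : ℂ)
    (h : ActsTo a F F') : ActsTo (r • a) F (r • F') := by
  unfold ActsTo at *
  rw [act_smul_left, h]
  funext x
  simp

theorem ActsTo.comp {a b : X.SkewRing Γ} {F F' F'' : ∀ x, Germ (X.nhd x) ℂ}
    (h : ActsTo a F' F'') (h' : ActsTo b F F') : ActsTo (a * b) F F'' := by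
  unfold ActsTo at *
  rw [act_mul, h', h]

theorem ActsTo.one (F : ∀ x, Germ (X.nhd x) ℂ) : ActsTo (1 : X.SkewRing Γ) F F := act_one _

/-- The family of all translates `φ_x(h)` of a germ `h` at the identity. -/
def translates (X : GeometricGroup G V) (h : Germ (X.nhd 1) ℂ) : ∀ x, Germ (X.nhd x) ℂ :=
  fun x => X.mulPull x⁻¹ (inv_mul_cancel x) h

/-- The family of translates of `h` is invariant under every left translation, so it passes through
each φ_ξ unchanged and commutes with the coefficients. This is the linearity that makes the kernel
of `toM` stable. -/
theorem ActsTo.translates_mul {a : X.SkewRing Γ} {F F' : ∀ x, Germ (X.nhd x) ℂ}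
    (h : Germ (X.nhd 1) ℂ) (hF : ActsTo a F F') :
    ActsTo a (X.translates h * F) (X.translates h * F') := by
  have hH : ∀ (ξ : Γ) y, X.translateGerm ξ y (X.restrictGeneric _ (X.translates h ((ξ : V)⁻¹ * y))) =
      X.restrictGeneric y (X.translates h y) := by
    intro ξ y
    induction h using Filter.Germ.inductionOn with | _ h =>
    refine congrArg (fun h : V → ℂ => (h : Germ (X.genericAt y) ℂ)) (funext fun z => ?_)
    simp
  have := act_mul_right a (H := fun x => X.restrictGeneric x (X.translates h x)) hH
    fun x => X.restrictGeneric x (F x)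
  unfold ActsTo at *
  rw [hF] at this
  convert this using 2
  · funext x; simp
  · simp

theorem ActsTo.globalToMer (f : X.globalInvariants) (F : ∀ x, Germ (X.nhd x) ℂ) :
    ActsTo (SkewMonoidAlgebra.single (1 : Γ) (X.globalToMer f)) F
      fun x => ((f : V → ℂ) : Germ (X.nhd x) ℂ) * F x := by
  have h1 := act_one (Γ := Γ) fun x => X.restrictGeneric x (F x)
  funext y
  have := congrFun h1 y
  rw [SkewMonoidAlgebra.one_def, act_single] at this
  rw [act_single, map_mul, ← this]
  simp only [OneMemClass.coe_one, map_one, one_mul]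
  rfl

end Action

/-! ### Invariant families and the averaging operator -/

section Average

variable {G V : Type*} [Group G] [Group V] [MulDistribMulAction G V] {X : GeometricGroup G V}
  {K : Subgroup G} {W : Set V}

theorem smulPull_smulPull (g g' : G) (x : V) (F : ∀ x, Germ (X.nhd x) ℂ) :
    X.smulPull g' rfl (X.smulPull g rfl (F (g • g' • x))) =
      X.smulPull (g * g') rfl (F ((g * g') • x)) := by
  have key : ∀ y y' (h : g • g' • x = y) (h' : (g * g') • x = y'), y = y' →
      X.smulPull g' rfl (X.smulPull g h (F y)) = X.smulPull (g * g') h' (F y') := by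
    rintro y _ h h' rfl
    induction F y using Filter.Germ.inductionOn with | _ f =>
    refine congrArg (fun h : V → ℂ => (h : Germ (X.nhd x) ℂ)) (funext fun z => ?_)
    simp [mul_smul]
  exact key _ _ rfl rfl (mul_smul g g' x).symm

theorem mulPull_translates (ξ : V) (h : Germ (X.nhd 1) ℂ) :
    X.mulPull ξ (mul_one ξ) (X.translates h ξ) = h := by
  induction h using Filter.Germ.inductionOn with | _ f =>
  refine congrArg (fun h : V → ℂ => (h : Germ (X.nhd 1) ℂ)) (funext fun z => ?_)
  simp

theorem translates_mulPull (ξ : V) (f : Germ (X.nhd ξ) ℂ) :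
    X.translates (X.mulPull ξ (mul_one ξ) f) ξ = f := by
  induction f using Filter.Germ.inductionOn with | _ f =>
  refine congrArg (fun h : V → ℂ => (h : Germ (X.nhd ξ) ℂ)) (funext fun z => ?_)
  simp

theorem translates_mul (h h' : Germ (X.nhd 1) ℂ) :
    X.translates (h * h') = X.translates h * X.translates h' := funext fun _ => map_mul _ _ _

theorem translates_mem {h : Germ (X.nhd 1) ℂ} (hh : h ∈ X.stalk 1) (x : V) :
    X.translates h x ∈ X.stalk x := X.mulPull_mem _ _ hh

theorem invariantStalk_le (x : V) {f : Germ (X.nhd x) ℂ} (hf : f ∈ X.invariantStalk K x) :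
    f ∈ X.stalk x := by
  obtain ⟨F, hF, rfl⟩ := hf
  exact hF.1 x

theorem smulPull_eq_of_mem_invariantStalk_one {h : Germ (X.nhd 1) ℂ}
    (hh : h ∈ X.invariantStalk K 1) {g : G} (hg : g ∈ K) : X.smulPull g (smul_one g) h = h := by
  obtain ⟨F, hF, rfl⟩ := hh
  have key : ∀ y (h : g • (1 : V) = y), X.smulPull g h (F y) = F 1 := by
    rintro y rfl
    exact hF.2 g hg 1
  exact key 1 (smul_one g)

/-- Since g is a group automorphism, (g x)⁻¹(g z) = g(x⁻¹ z); pulling back the translate at g x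
therefore gives the translate at x of the pulled-back germ. -/
theorem translates_mem_invariantFamilies_of_fixed {h : Germ (X.nhd 1) ℂ} (hh : h ∈ X.stalk 1)
    (hK : ∀ g ∈ K, X.smulPull g (smul_one g) h = h) : X.translates h ∈ X.invariantFamilies K := by
  refine ⟨translates_mem hh, fun g hg x => ?_⟩
  conv_rhs => rw [← hK g hg]
  induction h using Filter.Germ.inductionOn with | _ f =>
  refine congrArg (fun h : V → ℂ => (h : Germ (X.nhd x) ℂ)) (funext fun z => ?_)
  simp [smul_mul']

theorem translates_mem_invariantFamilies {h : Germ (X.nhd 1) ℂ}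
    (hh : h ∈ X.invariantStalk K 1) : X.translates h ∈ X.invariantFamilies K :=
  translates_mem_invariantFamilies_of_fixed (invariantStalk_le _ hh) fun _ =>
    smulPull_eq_of_mem_invariantStalk_one hh

theorem invariantFamilies_mul {F F' : ∀ x, Germ (X.nhd x) ℂ} (h : F ∈ X.invariantFamilies K)
    (h' : F' ∈ X.invariantFamilies K) : F * F' ∈ X.invariantFamilies K :=
  ⟨fun x => mul_mem (h.1 x) (h'.1 x), fun g hg x => by
    rw [Pi.mul_apply, Pi.mul_apply, map_mul, h.2 g hg, h'.2 g hg]⟩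

theorem invariantSum_mul {F F' : ∀ x, Germ (X.nhd x) ℂ} (h : F ∈ X.invariantFamilies K)
    (h' : F' ∈ X.invariantSum K W) : F * F' ∈ X.invariantSum K W :=
  ⟨invariantFamilies_mul h h'.1, h'.2.1.subset fun x hx h0 => hx (by simp [h0]),
    fun x hx => by simp [h'.2.2 x hx]⟩

variable (X K)

/-- The average over `K` of a family of germs. -/
def average [Fintype K] : (∀ x, Germ (X.nhd x) ℂ) →ₗ[ℂ] ∀ x, Germ (X.nhd x) ℂ where
  toFun F x := (Fintype.card K : ℂ)⁻¹ • ∑ g : K, X.smulPull g rfl (F (g.1 • x))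
  map_add' F F' := funext fun x => by simp [Finset.sum_add_distrib]
  map_smul' r F := funext fun x => by
    simp only [Pi.smul_apply, map_smul, ← Finset.smul_sum, RingHom.id_apply]
    rw [smul_comm]

variable {X K} [Fintype K]

theorem average_apply (F : ∀ x, Germ (X.nhd x) ℂ) (x : V) : X.average K F x =
    (Fintype.card K : ℂ)⁻¹ • ∑ g : K, X.smulPull g rfl (F (g.1 • x)) := rfl

theorem average_mem_invariantFamilies {F : ∀ x, Germ (X.nhd x) ℂ} (hF : ∀ x, F x ∈ X.stalk x) :
    X.average K F ∈ X.invariantFamilies K := by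
  refine ⟨fun x => Subalgebra.smul_mem _ (sum_mem fun g _ => X.smulPull_mem _ _ (hF _)) _,
    fun g' hg' x => ?_⟩
  rw [average_apply, average_apply, map_smul, map_sum]
  congr 1
  refine Fintype.sum_equiv (Equiv.mulRight (⟨g', hg'⟩ : K)) _ _ fun g => ?_
  exact smulPull_smulPull g.1 g' x F

theorem card_subgroup_ne_zero : (Fintype.card K : ℂ) ≠ 0 :=
  Nat.cast_ne_zero.2 Fintype.card_ne_zero

theorem average_eq_self {F : ∀ x, Germ (X.nhd x) ℂ} (hF : F ∈ X.invariantFamilies K) :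
    X.average K F = F := by
  funext x
  rw [average_apply, Finset.sum_congr rfl fun g _ => hF.2 g.1 g.2 x, Finset.sum_const,
    Finset.card_univ, ← Nat.cast_smul_eq_nsmul ℂ, smul_smul, inv_mul_cancel₀ card_subgroup_ne_zero,
    one_smul]

/-- Reynolds identity: averaging is linear over invariant families. -/
theorem average_mul {H : ∀ x, Germ (X.nhd x) ℂ} (hH : H ∈ X.invariantFamilies K)
    (F : ∀ x, Germ (X.nhd x) ℂ) : X.average K (H * F) = H * X.average K F := by
  funext x
  rw [Pi.mul_apply, average_apply, average_apply, mul_smul_comm, Finset.mul_sum]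
  congr 1
  refine Finset.sum_congr rfl fun g _ => ?_
  rw [Pi.mul_apply, map_mul, hH.2 g.1 g.2]

/-- The support of the average lies in the finite union of the K-translates of the support, and
stays in W because W is K-stable. -/
theorem average_mem_invariantSum (hW : ∀ g ∈ K, ∀ x ∈ W, g • x ∈ W)
    {F : ∀ x, Germ (X.nhd x) ℂ} (hF : ∀ x, F x ∈ X.stalk x) (hfin : {x | F x ≠ 0}.Finite)
    (hs : ∀ x ∉ W, F x = 0) : X.average K F ∈ X.invariantSum K W := by
  have h0 : ∀ x, (∀ g ∈ K, F (g • x) = 0) → X.average K F x = 0 := fun x hx => by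
    rw [average_apply, Finset.sum_eq_zero fun g _ => by rw [hx g.1 g.2, map_zero], smul_zero]
  refine ⟨average_mem_invariantFamilies hF, ?_, fun x hx => h0 x fun g hg => hs _ fun h => hx ?_⟩
  · refine (Set.finite_iUnion fun g : K => hfin.image fun x => g.1⁻¹ • x).subset fun x hx => ?_
    by_contra hn
    refine hx (h0 x fun g hg => ?_)
    by_contra hne
    exact hn (Set.mem_iUnion.2 ⟨⟨g, hg⟩, g • x, hne, by simp⟩)
  · simpa using hW g⁻¹ (inv_mem hg) _ h

end Average

/-! ### Kernel and surjectivity of the map to M(K, W) -/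

section Kernel

variable {G V : Type*} [Group G] [Group V] [MulDistribMulAction G V] {X : GeometricGroup G V}
  {K : Subgroup G} {W : Set V}

theorem mul_mem_translatedIdeal {ξ : V} {f t : Germ (X.nhd ξ) ℂ} (hf : f ∈ X.stalk ξ)
    (ht : t ∈ X.translatedIdeal K ξ) : f * t ∈ X.translatedIdeal K ξ := by
  obtain ⟨j, hj, he⟩ := ht
  refine ⟨⟨_, X.mulPull_mem ξ (mul_one ξ) hf⟩ * j, Ideal.mul_mem_left _ _ hj, ?_⟩
  have he' : j.1 = X.mulPull ξ (mul_one ξ) t := he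
  show X.mulPull ξ (mul_one ξ) f * j.1 = X.mulPull ξ (mul_one ξ) (f * t)
  rw [he', map_mul]

theorem translates_mem_translatedIdeal {h : X.stalk 1} (hh : h ∈ X.augmentationIdeal K) (ξ : V) :
    X.translates h.1 ξ ∈ X.translatedIdeal K ξ :=
  ⟨h, hh, (mulPull_translates ξ h.1).symm⟩

theorem toM_eq_zero_iff (F : X.invariantSum K W) :
    X.toM K W F = 0 ↔ ∀ ξ, F.1 ξ ∈ X.translatedIdeal K ξ := by
  rw [Subtype.ext_iff, funext_iff]
  exact forall_congr' fun ξ => Submodule.Quotient.mk_eq_zero _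

variable (X K W)

/-- The span of the products of invariant families with families of translates of an invariant
germ that vanishes at the identity. -/
def kernelSpan : Submodule ℂ (∀ x, Germ (X.nhd x) ℂ) :=
  Submodule.span ℂ {E | ∃ h ∈ X.invariantStalk K 1, @Germ.value V ℂ X.top 1 h = 0 ∧
    ∃ R ∈ X.invariantSum K W, E = X.translates h * R}

variable {X K W}

/-- An element of the translated ideal is a combination of products s·h with h an invariant germ
vanishing at e. Placed at the single point ξ, such a product is τ_h times a one-point family, and
τ_h, being invariant, comes out of the average. -/
theorem average_single_mem_kernelSpan [DecidableEq V] [Fintype K]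
    (hW : ∀ g ∈ K, ∀ x ∈ W, g • x ∈ W)
    {ξ : V} (hξ : ξ ∈ W) {t : Germ (X.nhd ξ) ℂ} (ht : t ∈ X.translatedIdeal K ξ) :
    X.average K (Pi.single ξ t) ∈ X.kernelSpan K W := by
  obtain ⟨j, hj, he⟩ := ht
  -- The arbitrary multiplier `s` absorbs ring coefficients, so that the scalar step of the span
  -- induction goes through.
  suffices H : ∀ s : X.stalk 1,
      X.average K (Pi.single ξ (X.translates (s * j).1 ξ)) ∈ X.kernelSpan K W by
    have h1 := H 1
    have he' : j.1 = X.mulPull ξ (mul_one ξ) t := he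
    rwa [one_mul, he', translates_mulPull] at h1
  refine Submodule.span_induction (p := fun j _ => ∀ s : X.stalk 1,
      X.average K (Pi.single ξ (X.translates (s * j).1 ξ)) ∈ X.kernelSpan K W) ?_ ?_ ?_ ?_ hj
  · rintro h ⟨h1, h2⟩ s
    have e : Pi.single ξ (X.translates (s * h).1 ξ) =
        X.translates h.1 * Pi.single ξ (X.translates s.1 ξ) := by
      funext x
      rw [mul_comm s h]
      show _ = X.translates h.1 x * _
      rcases eq_or_ne x ξ with rfl | hx
      · rw [Pi.single_eq_same, Pi.single_eq_same]
        exact congrFun (translates_mul h.1 s.1) x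
      · rw [Pi.single_eq_of_ne hx, Pi.single_eq_of_ne hx, mul_zero]
    rw [e, average_mul (translates_mem_invariantFamilies h1)]
    refine Submodule.subset_span ⟨h.1, h1, h2, _, average_mem_invariantSum hW (fun x => ?_)
      ((Set.finite_singleton ξ).subset fun x hx => ?_) (fun x hx => ?_), rfl⟩
    · rcases eq_or_ne x ξ with rfl | hx
      · rw [Pi.single_eq_same]; exact translates_mem s.2 _
      · rw [Pi.single_eq_of_ne hx]; exact zero_mem _
    · by_contra hne
      exact hx (Pi.single_eq_of_ne hne _)
    · exact Pi.single_eq_of_ne (by rintro rfl; exact hx hξ) _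
  · intro s
    have : X.translates (s * 0 : X.stalk 1).1 ξ = 0 := by
      rw [mul_zero]; exact map_zero (X.mulPull _ _)
    rw [this, Pi.single_zero, map_zero]
    exact zero_mem _
  · intro j j' _ _ h h' s
    have : X.translates (s * (j + j')).1 ξ =
        X.translates (s * j).1 ξ + X.translates (s * j').1 ξ := by
      rw [mul_add]; exact map_add (X.mulPull _ _) _ _
    rw [this, Pi.single_add, map_add]
    exact add_mem (h s) (h' s)
  · intro r j _ h s
    rw [smul_eq_mul, ← mul_assoc]
    exact h _

/-- An invariant family equals its own average, hence the sum of the averages of its finitely many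
one-point components. -/
theorem mem_kernelSpan [Finite K] (hW : ∀ g ∈ K, ∀ x ∈ W, g • x ∈ W)
    {F : ∀ x, Germ (X.nhd x) ℂ} (hF : F ∈ X.invariantSum K W)
    (h : ∀ ξ, F ξ ∈ X.translatedIdeal K ξ) : F ∈ X.kernelSpan K W := by
  classical
  have := Fintype.ofFinite K
  rw [← average_eq_self hF.1]
  have e : F = ∑ ξ ∈ hF.2.1.toFinset, Pi.single ξ (F ξ) := by
    funext x
    rw [Finset.sum_apply]
    by_cases hx : F x = 0
    · rw [hx, Finset.sum_eq_zero]
      intro ξ _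
      rcases eq_or_ne x ξ with rfl | hne
      · rw [Pi.single_eq_same, hx]
      · rw [Pi.single_eq_of_ne hne]
    · rw [Finset.sum_eq_single x, Pi.single_eq_same]
      · exact fun ξ _ hne => Pi.single_eq_of_ne hne.symm _
      · exact fun hn => absurd (by simpa using hx) hn
  rw [e, map_sum]
  refine sum_mem fun ξ hξ => average_single_mem_kernelSpan hW ?_ (h ξ)
  by_contra hn
  simp only [Set.Finite.mem_toFinset, Set.mem_ofPred_eq] at hξ
  exact hξ (hF.2.2 ξ hn)

/-- The vector space of the invariant families with zero class in `M(K, W)` is preserved. -/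
theorem exists_actsTo_of_mem_kernelSpan {Γ : Subgroup V} {A : Subalgebra ℂ (X.SkewRing Γ)}
    (hA : Preserves A K W) {a : X.SkewRing Γ} (ha : a ∈ A) {F : ∀ x, Germ (X.nhd x) ℂ}
    (hF : F ∈ X.kernelSpan K W) :
    ∃ F' ∈ X.invariantSum K W, ActsTo a F F' ∧ ∀ ξ, F' ξ ∈ X.translatedIdeal K ξ := by
  refine Submodule.span_induction (p := fun F _ => ∃ F' ∈ X.invariantSum K W, ActsTo a F F' ∧
    ∀ ξ, F' ξ ∈ X.translatedIdeal K ξ) ?_ ?_ ?_ ?_ hF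
  -- On a generator, a(τ_h R) = τ_h · R' with R' = aR; every component is a multiple of a translate
  -- of h, hence in the translated ideal.
  · rintro _ ⟨h, h1, h2, R, hR, rfl⟩
    obtain ⟨R', hR', hact⟩ := hA a ha R hR
    refine ⟨_, invariantSum_mul (translates_mem_invariantFamilies h1) hR', hact.translates_mul h,
      fun ξ => ?_⟩
    rw [Pi.mul_apply, mul_comm]
    exact mul_mem_translatedIdeal (hR'.1.1 ξ) (translates_mem_translatedIdeal
      (h := ⟨h, invariantStalk_le _ h1⟩) (Ideal.subset_span ⟨h1, h2⟩) ξ)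
  · exact ⟨0, zero_mem _, ActsTo.zero a, fun ξ => zero_mem _⟩
  · rintro F E - - ⟨F', h1, h2, h3⟩ ⟨E', h1', h2', h3'⟩
    exact ⟨_, add_mem h1 h1', h2.add h2', fun ξ => add_mem (h3 ξ) (h3' ξ)⟩
  · rintro r F - ⟨F', h1, h2, h3⟩
    exact ⟨_, Submodule.smul_mem _ r h1, h2.smul r, fun ξ => Submodule.smul_mem _ r (h3 ξ)⟩

/-- Lift each class separately and average: the given classes are already invariant, so averaging
does not change them. -/
theorem toM_surjective [Finite K] (hW : ∀ g ∈ K, ∀ x ∈ W, g • x ∈ W) :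
    Function.Surjective (X.toM K W) := by
  classical
  have := Fintype.ofFinite K
  rintro ⟨c, hfin, hs, hinv⟩
  choose f hf using fun ξ => Submodule.Quotient.mk_surjective _ (c ξ)
  -- The zero class is lifted to the zero germ, which keeps the support finite and inside W.
  let F : ∀ x, X.invariantStalk K x := fun x => if c x = 0 then 0 else f x
  have hF : ∀ x, (Submodule.Quotient.mk (F x) : X.Fibre K x) = c x := fun x => by
    by_cases h : c x = 0
    · simp [F, h]
    · simp [F, h, hf]
  have hF0 : ∀ x, c x = 0 → (F x).1 = 0 := fun x h => by simp [F, h]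
  refine ⟨⟨X.average K fun x => (F x).1, average_mem_invariantSum hW
    (fun x => invariantStalk_le x (F x).2) (hfin.subset fun x hx h => hx (hF0 x h))
    fun x hx => hF0 x (hs x hx)⟩, Subtype.ext (funext fun ξ => ?_)⟩
  have e : X.average K (fun x => (F x).1) ξ = ((Fintype.card K : ℂ)⁻¹ • ∑ g : K,
      (⟨X.smulPull g.1 rfl (F (g.1 • ξ)).1, X.smulPull_mem_invariantStalk g.2 ξ (F _).2⟩ :
        X.invariantStalk K ξ) : X.invariantStalk K ξ).1 := by
    rw [average_apply]; simp
  have e' : ∀ g : K, Submodule.mkQ ((X.translatedIdeal K ξ).submoduleOf (X.invariantStalk K ξ))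
      ⟨X.smulPull g.1 rfl (F (g.1 • ξ)).1, X.smulPull_mem_invariantStalk g.2 ξ (F _).2⟩ =
        c ξ := by
    intro g
    rw [← hinv g.1 g.2 ξ, ← hF (g.1 • ξ)]
    rfl
  refine (congrArg Submodule.Quotient.mk (Subtype.ext e)).trans ?_
  show Submodule.mkQ _ _ = c ξ
  rw [map_smul, map_sum, Finset.sum_congr rfl fun g _ => e' g, Finset.sum_const, Finset.card_univ,
    ← Nat.cast_smul_eq_nsmul ℂ, smul_smul, inv_mul_cancel₀ card_subgroup_ne_zero, one_smul]

end Kernel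

/-! ### The induced module and the Harish-Chandra property -/

section Induced

variable {G V : Type*} [Group G] [Group V] [MulDistribMulAction G V] {X : GeometricGroup G V}
  {K : Subgroup G} {W : Set V} {Γ : Subgroup V} {A : Subalgebra ℂ (X.SkewRing Γ)}

variable (X) in
/-- A germ of a function is determined by its restriction to a dense open set. -/
def GenericallyFaithful : Prop :=
  ∀ x, ∀ f ∈ X.stalk x, X.restrictGeneric x f = 0 → f = 0

/-- The action determines the result only as generically defined germs; faithfulness upgrades this
to equality of germs of functions. -/
theorem ActsTo.unique (hX : X.GenericallyFaithful) {a : X.SkewRing Γ}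
    {F F' F'' : ∀ x, Germ (X.nhd x) ℂ} (h' : ActsTo a F F') (h'' : ActsTo a F F'')
    (hF' : ∀ x, F' x ∈ X.stalk x) (hF'' : ∀ x, F'' x ∈ X.stalk x) : F' = F'' := by
  funext x
  have h := congrFun (h'.symm.trans h'') x
  refine sub_eq_zero.1 (hX x _ (sub_mem (hF' x) (hF'' x)) ?_)
  rw [map_sub]
  exact sub_eq_zero.2 h

/-- A relation that behaves like the graph of an action of `A` on `O` induces an `A`-module structure
on a quotient of `O`, if the classes of the images depend only on the classes. -/
theorem exists_algHom_of_relation {A O N : Type*} [Semiring A] [Algebra ℂ A] [AddCommMonoid O]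
    [Module ℂ O] [AddCommMonoid N] [Module ℂ N] (π : O →ₗ[ℂ] N) (hπ : Function.Surjective π)
    (R : A → O → O → Prop) (hex : ∀ a x, ∃ y, R a x y)
    (hadd : ∀ a x x' y y', R a x y → R a x' y' → R a (x + x') (y + y'))
    (hsmul : ∀ a (r : ℂ) x y, R a x y → R a (r • x) (r • y))
    (hone : ∀ x, R 1 x x) (hmul : ∀ a b x y z, R a y z → R b x y → R (a * b) x z)
    (hadd_left : ∀ a b x y z, R a x y → R b x z → R (a + b) x (y + z))
    (hsmul_left : ∀ (r : ℂ) a x y, R a x y → R (r • a) x (r • y))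
    (hwd : ∀ a x y x' y', R a x y → R a x' y' → π x = π x' → π y = π y') :
    ∃ ρ : A →ₐ[ℂ] Module.End ℂ N, ∀ a x y, R a x y → ρ a (π x) = π y := by
  choose T hT using hex
  choose s hs using hπ
  -- The chosen image `T` and section `s` are not linear; by `hwd` their class agrees with that of
  -- any related pair, and all algebra axioms are checked through such pairs.
  have key : ∀ a x y, R a x y → π (T a (s (π x))) = π y := fun a x y h =>
    hwd a _ _ _ _ (hT a _) h (hs _)
  have key' : ∀ a m y, R a (s m) y → π (T a (s m)) = π y := fun a m y h => by
    have := key a _ _ h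
    rwa [hs] at this
  refine ⟨{
    toFun := fun a =>
      { toFun := fun m => π (T a (s m))
        map_add' := fun m m' => ?_
        map_smul' := fun r m => ?_ }
    map_one' := LinearMap.ext fun m => (key' 1 m _ (hone _)).trans (hs m)
    map_mul' := fun a b => LinearMap.ext fun m => ?_
    map_zero' := LinearMap.ext fun m => ?_
    map_add' := fun a b => LinearMap.ext fun m =>
      (key' _ m _ (hadd_left _ _ _ _ _ (hT a _) (hT b _))).trans (map_add π _ _)
    commutes' := fun r => LinearMap.ext fun m => ?_ }, key⟩
  · have := key a _ _ (hadd a _ _ _ _ (hT a (s m)) (hT a (s m')))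
    rwa [map_add, map_add, hs, hs] at this
  · have := key a _ _ (hsmul a r _ _ (hT a (s m)))
    rwa [map_smul, map_smul, hs] at this
  · refine (key' _ m _ (hmul _ _ _ _ _ (hT a _) (hT b _))).trans ?_
    exact (key a _ _ (hT a _)).symm
  · have := key' _ m _ (hsmul_left 0 1 _ _ (hone _))
    rwa [zero_smul, zero_smul, map_zero] at this
  · have := key' _ m _ (hsmul_left r 1 _ _ (hone _))
    rw [map_smul, hs, ← Algebra.algebraMap_eq_smul_one] at this
    exact this

theorem finite_of_injective_pi {ι N : Type*} [Finite ι] [AddCommMonoid N] [Module ℂ N]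
    {E : ι → Type*} [∀ i, AddCommMonoid (E i)] [∀ i, Module ℂ (E i)]
    (hE : ∀ i, Module.Finite ℂ (E i)) (φ : N →ₗ[ℂ] ∀ i, E i) (hφ : Function.Injective φ) :
    Module.Finite ℂ N :=
  let _ := fun i => Module.addCommMonoidToAddCommGroup ℂ (M := E i)
  Module.Finite.of_injective φ hφ

/-- The difference F - E lies in the kernel, which `a` preserves; adding its image D to E' gives
another image of F, equal to F' by uniqueness. -/
theorem toM_eq_of_actsTo [Finite K] (hX : X.GenericallyFaithful)
    (hW : ∀ g ∈ K, ∀ x ∈ W, g • x ∈ W) (hA : Preserves A K W) (a : A)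
    {F F' E E' : X.invariantSum K W} (h : ActsTo a.1 F.1 F'.1) (h' : ActsTo a.1 E.1 E'.1)
    (hFE : X.toM K W F = X.toM K W E) : X.toM K W F' = X.toM K W E' := by
  have h0 : ∀ ξ, (F - E).1 ξ ∈ X.translatedIdeal K ξ := fun ξ => by
    have e : (Submodule.Quotient.mk ⟨F.1 ξ, X.mem_invariantStalk F.2 ξ⟩ : X.Fibre K ξ) =
      Submodule.Quotient.mk ⟨E.1 ξ, X.mem_invariantStalk E.2 ξ⟩ :=
        congrFun (congrArg Subtype.val hFE) ξ
    have := (Submodule.Quotient.eq _).1 e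
    exact this
  obtain ⟨D, hD, hact, hker⟩ := exists_actsTo_of_mem_kernelSpan hA a.2
    (mem_kernelSpan hW (F - E).2 h0)
  have h1 : ActsTo a.1 F.1 (D + E'.1) := by
    have := hact.add h'
    rwa [Submodule.coe_sub, sub_add_cancel] at this
  have h2 : F'.1 = D + E'.1 := h.unique hX h1 F'.2.1.1 fun x =>
    add_mem (hD.1.1 x) (E'.2.1.1 x)
  obtain rfl : F' = ⟨D, hD⟩ + E' := Subtype.ext h2
  rw [map_add, (toM_eq_zero_iff ⟨D, hD⟩).2 hker, zero_add]

theorem exists_isInduced [Finite K] (hX : X.GenericallyFaithful)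
    (hW : ∀ g ∈ K, ∀ x ∈ W, g • x ∈ W) (hA : Preserves A K W) :
    ∃ ρ : A →ₐ[ℂ] Module.End ℂ (X.M K W), IsInduced A K W ρ := by
  have hadd : ∀ (a b : A) (F F' F'' : X.invariantSum K W), ActsTo a.1 F.1 F'.1 →
      ActsTo b.1 F.1 F''.1 → ActsTo (a + b).1 F.1 (F' + F'').1 := fun a b F F' F'' h h' => by
    rw [Subalgebra.coe_add, Submodule.coe_add]
    exact h.add_left h'
  have hsmul : ∀ (r : ℂ) (a : A) (F F' : X.invariantSum K W), ActsTo a.1 F.1 F'.1 →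
      ActsTo (r • a).1 F.1 (r • F').1 := fun r a F F' h => by
    rw [Subalgebra.coe_smul, Submodule.coe_smul]
    exact h.smul_left r
  refine exists_algHom_of_relation (X.toM K W) (toM_surjective hW)
    (fun (a : A) F F' => ActsTo a.1 F.1 F'.1) (fun a F => ?_)
    (fun a F E F' E' h h' => h.add h') (fun a r F F' h => h.smul r) (fun F => ActsTo.one F.1)
    (fun a b F F' F'' h h' => h.comp h') hadd hsmul
    (fun a F F' E E' h h' e => toM_eq_of_actsTo hX hW hA a h h' e)
  obtain ⟨F', hF', h⟩ := hA a.1 a.2 F.1 F.2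
  exact ⟨⟨F', hF'⟩, h⟩

/-- Every class comes from some F, and `hA` supplies an image F' whose class both structures must
return. -/
theorem IsInduced.unique [Finite K] (hW : ∀ g ∈ K, ∀ x ∈ W, g • x ∈ W) (hA : Preserves A K W)
    {ρ ρ' : A →ₐ[ℂ] Module.End ℂ (X.M K W)} (h : IsInduced A K W ρ) (h' : IsInduced A K W ρ') :
    ρ' = ρ := by
  refine AlgHom.ext fun a => LinearMap.ext fun m => ?_
  obtain ⟨F, rfl⟩ := toM_surjective hW m
  obtain ⟨F', hF', hact⟩ := hA a.1 a.2 F.1 F.2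
  exact (h' a F ⟨F', hF'⟩ hact).trans (h a F ⟨F', hF'⟩ hact).symm

theorem globalInvariants_mem_invariantFamilies (f : X.globalInvariants) :
    (fun x => ((f : V → ℂ) : Germ (X.nhd x) ℂ)) ∈ X.invariantFamilies K :=
  ⟨f.2.1, fun g _ x => congrArg (fun h : V → ℂ => (h : Germ (X.nhd x) ℂ))
    (funext fun z => f.2.2 g z)⟩

/-- The fibres are finite-dimensional when the augmentation ideal has finite codimension. -/
theorem finite_fibre (hJ : Module.Finite ℂ (X.stalk 1 ⧸ X.augmentationIdeal K)) (ξ : V) :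
    Module.Finite ℂ (X.Fibre K ξ) := by
  let φ : X.invariantStalk K ξ →ₗ[ℂ] X.stalk 1 :=
    { toFun := fun f => ⟨X.mulPull ξ (mul_one ξ) f.1, X.mulPull_mem _ _ (invariantStalk_le _ f.2)⟩
      map_add' := fun f f' => Subtype.ext (map_add _ _ _)
      map_smul' := fun r f => Subtype.ext (map_smul _ _ _) }
  let ψ := (Ideal.Quotient.mkₐ ℂ (X.augmentationIdeal K)).toLinearMap ∘ₗ φ
  have hψ : (X.translatedIdeal K ξ).submoduleOf (X.invariantStalk K ξ) = LinearMap.ker ψ := by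
    ext f
    rw [LinearMap.mem_ker]
    refine Iff.trans ?_ Ideal.Quotient.eq_zero_iff_mem.symm
    constructor
    · rintro ⟨j, hj, he⟩
      obtain rfl : j = φ f := Subtype.ext he
      exact hj
    · exact fun h => ⟨φ f, h, rfl⟩
  unfold Fibre
  rw [hψ]
  exact Module.Finite.of_injective _ (LinearMap.ker_eq_bot.1 (Submodule.ker_liftQ_eq_bot' _ ψ rfl))

theorem IsInduced.isHarishChandra [Finite K] (hW : ∀ g ∈ K, ∀ x ∈ W, g • x ∈ W)
    (hJ : Module.Finite ℂ (X.stalk 1 ⧸ X.augmentationIdeal K))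
    {ρ : A →ₐ[ℂ] Module.End ℂ (X.M K W)} (h : IsInduced A K W ρ) : IsHarishChandra A ρ := by
  intro m
  let S := {ξ | m.1 ξ ≠ 0}
  have hS : S.Finite := m.2.1
  -- All elements supported in the support of `m`: they embed in a finite product of fibres, and
  -- multiplication by functions does not enlarge supports.
  let L : Submodule ℂ (X.M K W) :=
    { carrier := {l | ∀ ξ ∉ S, l.1 ξ = 0}
      add_mem' := fun {l l'} h h' ξ hξ => by
        simp [h ξ hξ, h' ξ hξ]
      zero_mem' := fun _ _ => rfl
      smul_mem' := fun r l h ξ hξ => by simp [h ξ hξ] }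
  refine ⟨L, fun ξ hξ => not_not.1 hξ, ?_, ?_⟩
  · have := hS.to_subtype
    have := fun ξ : S => finite_fibre hJ ξ.1
    let φ : L →ₗ[ℂ] ∀ ξ : S, X.Fibre K ξ.1 :=
      { toFun := fun l ξ => l.1.1 ξ.1
        map_add' := fun _ _ => rfl
        map_smul' := fun _ _ => rfl }
    refine finite_of_injective_pi this φ fun l l' hll => Subtype.ext (Subtype.ext (funext fun ξ => ?_))
    by_cases hξ : ξ ∈ S
    · exact congrFun hll ⟨ξ, hξ⟩
    · exact (l.2 ξ hξ).trans (l'.2 ξ hξ).symm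
  · rintro ⟨_, hb⟩ ⟨f, rfl⟩ l hl ξ hξ
    obtain ⟨F, rfl⟩ := toM_surjective hW l
    have hF : (Submodule.Quotient.mk ⟨F.1 ξ, X.mem_invariantStalk F.2 ξ⟩ : X.Fibre K ξ) = 0 :=
      hl ξ hξ
    let F' : X.invariantSum K W :=
      ⟨_, invariantSum_mul (globalInvariants_mem_invariantFamilies f) F.2⟩
    have e := h ⟨_, hb⟩ F F' (ActsTo.globalToMer f F.1)
    refine (congrFun (congrArg Subtype.val e) ξ).trans ?_
    have h1 := (Submodule.Quotient.mk_eq_zero _).1 hF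
    exact (Submodule.Quotient.mk_eq_zero _).2 (mul_mem_translatedIdeal (f.2.1 ξ) h1)

theorem Preserves.mIsHarishChandra [Finite K] (hX : X.GenericallyFaithful)
    (hJ : Module.Finite ℂ (X.stalk 1 ⧸ X.augmentationIdeal K))
    (hW : ∀ g ∈ K, ∀ x ∈ W, g • x ∈ W) (hA : Preserves A K W) : MIsHarishChandra A K W := by
  obtain ⟨ρ, hρ⟩ := exists_isInduced hX hW hA
  exact ⟨hA, ρ, hρ, fun ρ' hρ' => hρ.unique hW hA hρ', hρ.isHarishChandra hW hJ⟩

end Induced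

/-! ### Passing from the big orbit to the small orbit -/

section Orbits

variable {G V : Type*} [Group G] [Group V] [MulDistribMulAction G V] {X : GeometricGroup G V}
  {Γ : Subgroup V} {A : Subalgebra ℂ (X.SkewRing Γ)} {K : Subgroup G}

theorem mul_mem_smallOrbit_iff {v x ξ : V} (hξ : ξ ∈ Γ) :
    ξ * x ∈ smallOrbit Γ v ↔ x ∈ smallOrbit Γ v := by
  constructor
  · rintro ⟨η, hη, h⟩
    exact ⟨ξ⁻¹ * η, mul_mem (inv_mem hξ) hη, by rw [mul_assoc, ← h, inv_mul_cancel_left]⟩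
  · rintro ⟨η, hη, rfl⟩
    exact ⟨ξ * η, mul_mem hξ hη, (mul_assoc _ _ _).symm⟩

theorem smul_mem_bigOrbit (hΓ : ∀ g : G, ∀ ξ ∈ Γ, g • ξ ∈ Γ) {v x : V} {g : G} (hg : g ∈ K)
    (hx : x ∈ bigOrbit K Γ v) : g • x ∈ bigOrbit K Γ v := by
  obtain ⟨ξ, hξ, g', hg', rfl⟩ := hx
  exact ⟨g • ξ, hΓ g ξ hξ, g * g', mul_mem hg hg', by rw [smul_mul', mul_smul]⟩

theorem smallOrbit_subset_bigOrbit (v : V) : smallOrbit Γ v ⊆ bigOrbit K Γ v := by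
  rintro _ ⟨ξ, hξ, rfl⟩
  exact ⟨ξ, hξ, 1, one_mem _, by rw [one_smul]⟩

theorem smul_mem_smallOrbit {v x : V} {g : G} (hg : g ∈ orbitStabilizer K Γ v)
    (hx : x ∈ smallOrbit Γ v) : g • x ∈ smallOrbit Γ v := by
  have h := MulAction.mem_stabilizer_iff.1 hg.2
  rw [← h]
  exact Set.smul_mem_smul_set hx

/-- As Γ is G-stable, g maps Γ-orbits to Γ-orbits, and two orbits that meet coincide; a single point
of Γv sent into Γv is enough. -/
theorem mem_orbitStabilizer_of_smul_mem (hΓ : ∀ g : G, ∀ ξ ∈ Γ, g • ξ ∈ Γ) {v x : V} {g : G}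
    (hg : g ∈ K) (hx : x ∈ smallOrbit Γ v) (hgx : g • x ∈ smallOrbit Γ v) :
    g ∈ orbitStabilizer K Γ v := by
  have hsub : ∀ (g : G) (x : V), x ∈ smallOrbit Γ v → g • x ∈ smallOrbit Γ v →
      g • smallOrbit Γ v ⊆ smallOrbit Γ v := by
    rintro g _ ⟨ξ, hξ, rfl⟩ hgx _ ⟨_, ⟨η, hη, rfl⟩, rfl⟩
    rw [smul_mul', mul_mem_smallOrbit_iff (hΓ g ξ hξ)] at hgx
    show g • (η * v) ∈ _
    rwa [smul_mul', mul_mem_smallOrbit_iff (hΓ g η hη)]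
  refine ⟨hg, MulAction.mem_stabilizer_iff.2 ((hsub g x hx hgx).antisymm ?_)⟩
  have := hsub g⁻¹ _ hgx (by simpa using hx)
  rwa [← Set.subset_smul_set_iff] at this

/-- Invariant families along `Γ v` are restrictions of invariant families along `(K ⋉ Γ) v`. -/
theorem exists_extension [Finite G] (hΓ : ∀ g : G, ∀ ξ ∈ Γ, g • ξ ∈ Γ) {v : V}
    {F : ∀ x, Germ (X.nhd x) ℂ}
    (hF : F ∈ X.invariantSum (orbitStabilizer K Γ v) (smallOrbit Γ v)) :
    ∃ E ∈ X.invariantSum K (bigOrbit K Γ v), ∀ x ∈ smallOrbit Γ v, E x = F x := by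
  classical
  have := Fintype.ofFinite K
  let c : ℂ := ((Finset.univ.filter fun g : K => g.1 ∈ orbitStabilizer K Γ v).card : ℂ)
  have hc : c ≠ 0 := Nat.cast_ne_zero.2 (Finset.card_ne_zero.2 ⟨1, by simp [one_mem]⟩)
  -- At a point of Γv only the `c` summands with g in the stabilizer survive, each equal to F x. The
  -- factor replaces the normalization 1/|K| by 1/c.
  refine ⟨(c⁻¹ * Fintype.card K) • X.average K F, Submodule.smul_mem _ _
    (average_mem_invariantSum (fun g hg x => smul_mem_bigOrbit hΓ hg) hF.1.1 hF.2.1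
      fun x hx => hF.2.2 x fun h => hx (smallOrbit_subset_bigOrbit v h)), fun x hx => ?_⟩
  rw [Pi.smul_apply, average_apply, smul_smul, mul_assoc, mul_inv_cancel₀ card_subgroup_ne_zero,
    mul_one, ← Finset.sum_filter_add_sum_filter_not _ fun g : K => g.1 ∈ orbitStabilizer K Γ v,
    Finset.sum_congr rfl fun g hg => hF.1.2 g.1 (Finset.mem_filter.1 hg).2 x, Finset.sum_const,
    Finset.sum_eq_zero (s := Finset.univ.filter fun g : K => g.1 ∉ orbitStabilizer K Γ v),
    add_zero, ← Nat.cast_smul_eq_nsmul ℂ, smul_smul, inv_mul_cancel₀ hc, one_smul]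
  intro g hg
  rw [hF.2.2 _ fun h => (Finset.mem_filter.1 hg).2 (mem_orbitStabilizer_of_smul_mem hΓ g.2 hx h),
    map_zero]

/-- Extend to the big orbit, apply `a` there, and cut the result off outside Γv. By `act_congr` the
values on Γv see only F, while those elsewhere see only zeros. -/
theorem Preserves.smallOrbit [Finite G] (hΓ : ∀ g : G, ∀ ξ ∈ Γ, g • ξ ∈ Γ) {v : V}
    (hA : Preserves A K (bigOrbit K Γ v)) :
    Preserves A (orbitStabilizer K Γ v) (smallOrbit Γ v) := by
  classical
  intro a ha F hF
  obtain ⟨E, hE, hEF⟩ := exists_extension hΓ hF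
  obtain ⟨E', hE', hact⟩ := hA a ha E hE
  refine ⟨fun x => if x ∈ HarishChandra.smallOrbit Γ v then E' x else 0,
    ⟨⟨fun x => ?_, fun g hg x => ?_⟩, hE'.2.1.subset fun x hx h => hx (by simp [h]), fun x hx => ?_⟩,
    funext fun x => ?_⟩
  · dsimp only
    split_ifs
    exacts [hE'.1.1 x, zero_mem _]
  · dsimp only
    by_cases hx : x ∈ HarishChandra.smallOrbit Γ v
    · rw [if_pos hx, if_pos (smul_mem_smallOrbit hg hx), hE'.1.2 g hg.1 x]
    · rw [if_neg hx, if_neg, map_zero]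
      exact fun h => hx (by simpa using smul_mem_smallOrbit (inv_mem hg) h)
  · exact if_neg hx
  · dsimp only
    by_cases hx : x ∈ HarishChandra.smallOrbit Γ v
    · rw [if_pos hx, ← congrFun hact x]
      exact act_congr a fun ξ hξ => by rw [hEF _ ((mul_mem_smallOrbit_iff hξ).2 hx)]
    · rw [if_neg hx]
      refine Eq.trans ?_ (congrFun (ActsTo.zero a) x)
      exact act_congr a fun ξ hξ => by
        rw [hF.2.2 _ fun h => hx ((mul_mem_smallOrbit_iff hξ).1 h)]; rfl

end Orbits

/-! ### Finite codimension of the augmentation ideal -/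

section Codimension

/-- An ideal whose radical is a finitely generated ideal of codimension one has finite
codimension. -/
theorem finite_quotient_of_ker_le_radical {R : Type*} [CommRing R] [Algebra ℂ R] (ε : R →ₐ[ℂ] ℂ)
    (hfg : (RingHom.ker ε).FG) {J : Ideal R} (hJ : J ≤ RingHom.ker ε)
    (hr : RingHom.ker ε ≤ J.radical) : Module.Finite ℂ (R ⧸ J) := by
  let f : R ⧸ J →ₐ[ℂ] ℂ := Ideal.Quotient.liftₐ J ε fun a ha => hJ ha
  have hker : RingHom.ker f = (RingHom.ker ε).map (Ideal.Quotient.mk J) := by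
    refine le_antisymm (fun x hx => ?_) (Ideal.map_le_iff_le_comap.2 fun x hx => hx)
    obtain ⟨x, rfl⟩ := Ideal.Quotient.mk_surjective x
    exact Ideal.mem_map_of_mem _ hx
  -- In R/J the image of ker ε is finitely generated and consists of nilpotents, and the quotient by
  -- it is ℂ.
  refine Module.finite_of_surjective_of_ker_le_nilradical f
    (fun r => ⟨algebraMap ℂ _ r, f.commutes r⟩) ?_ ?_
  · rw [hker, Ideal.map_le_iff_le_comap]
    intro x hx
    obtain ⟨n, hn⟩ := hr hx
    exact ⟨n, by rw [← map_pow]; exact Ideal.Quotient.eq_zero_iff_mem.2 hn⟩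
  · rw [hker]
    exact hfg.map _

variable {G V : Type*} [Group G] [Group V] [MulDistribMulAction G V] {X : GeometricGroup G V}
  {K : Subgroup G}

variable (X) in
/-- The value at the identity. -/
def valueAtOne : X.stalk 1 →ₐ[ℂ] ℂ where
  toFun f := @Germ.value V ℂ X.top 1 f.1
  map_one' := rfl
  map_mul' f f' := map_mul (@Germ.valueMulHom V ℂ _ X.top 1) f.1 f'.1
  map_zero' := rfl
  map_add' f f' := map_add (@Germ.valueAddHom V ℂ _ X.top 1) f.1 f'.1
  commutes' r := by
    rw [Algebra.algebraMap_eq_smul_one]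
    exact mul_one r

theorem augmentationIdeal_le_ker : X.augmentationIdeal K ≤ RingHom.ker X.valueAtOne :=
  Ideal.span_le.2 fun _ hf => hf.2

theorem translates_one (h : Germ (X.nhd 1) ℂ) : X.translates h 1 = h := by
  induction h using Filter.Germ.inductionOn with | _ f =>
  refine congrArg (fun h : V → ℂ => (h : Germ (X.nhd 1) ℂ)) (funext fun z => ?_)
  simp

theorem value_smulPull (g : G) (f : Germ (X.nhd 1) ℂ) :
    @Germ.value V ℂ X.top 1 (X.smulPull g (smul_one g) f) = @Germ.value V ℂ X.top 1 f := by
  induction f using Filter.Germ.inductionOn with | _ f =>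
  exact congrArg f (smul_one g)

/-- The action of `K` on the stalk at the identity. -/
@[reducible]
def stalkAction (X : GeometricGroup G V) (K : Subgroup G) : MulSemiringAction K (X.stalk 1) where
  smul g f := ⟨X.smulPull g.1⁻¹ (smul_one _) f.1, X.smulPull_mem _ _ f.2⟩
  one_smul := by
    rintro ⟨f, hf⟩
    refine Subtype.ext (show X.smulPull (1 : G)⁻¹ (smul_one _) f = f from ?_)
    induction f using Filter.Germ.inductionOn with | _ f =>
    refine congrArg (fun h : V → ℂ => (h : Germ (X.nhd 1) ℂ)) (funext fun z => ?_)
    simp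
  mul_smul := by
    rintro ⟨g, hg⟩ ⟨g', hg'⟩ ⟨f, hf⟩
    refine Subtype.ext (show X.smulPull (g * g')⁻¹ (smul_one _) f =
      X.smulPull g⁻¹ (smul_one _) (X.smulPull g'⁻¹ (smul_one _) f) from ?_)
    induction f using Filter.Germ.inductionOn with | _ f =>
    refine congrArg (fun h : V → ℂ => (h : Germ (X.nhd 1) ℂ)) (funext fun z => ?_)
    simp [mul_smul]
  smul_zero g := Subtype.ext (map_zero (X.smulPull _ _))
  smul_add g a b := Subtype.ext (map_add (X.smulPull _ _) a.1 b.1)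
  smul_one g := Subtype.ext (map_one (X.smulPull _ _))
  smul_mul g a b := Subtype.ext (map_mul (X.smulPull _ _) a.1 b.1)

/-- Integrality over the invariants: f is a root of the product of T - g·f over K. All conjugates of
f vanish at e because g fixes e, so at e this polynomial becomes T^|K| and its other coefficients
lie in the augmentation ideal. -/
theorem ker_le_radical_augmentationIdeal [Finite K] :
    RingHom.ker X.valueAtOne ≤ (X.augmentationIdeal K).radical := by
  have := Fintype.ofFinite K
  let _ := stalkAction X K
  intro f hf
  let P := MulSemiringAction.charpoly K f
  have hP : P.map X.valueAtOne.toRingHom = Polynomial.X ^ Fintype.card K := by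
    simp only [P, MulSemiringAction.charpoly_eq, Polynomial.map_prod, Polynomial.map_sub,
      Polynomial.map_X, Polynomial.map_C]
    have h0 : ∀ g : K, X.valueAtOne (g • f) = 0 := fun g =>
      (value_smulPull g.1⁻¹ f.1).trans hf
    simp [h0]
  have hmem : ∀ k ≠ Fintype.card K, P.coeff k ∈ X.augmentationIdeal K := by
    intro k hk
    -- The translates of an invariant coefficient give a K-invariant family on all of V having that
    -- coefficient as component at e.
    refine Ideal.subset_span ⟨⟨X.translates (P.coeff k).1,
      translates_mem_invariantFamilies_of_fixed (P.coeff k).2 fun g hg => ?_, ?_⟩, ?_⟩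
    · have h := congrArg Subtype.val
        (MulSemiringAction.smul_coeff_charpoly f k (⟨g⁻¹, inv_mem hg⟩ : K))
      have h' : X.smulPull g⁻¹⁻¹ (smul_one _) (P.coeff k).1 = (P.coeff k).1 := h
      simpa only [inv_inv] using h'
    · exact translates_one _
    · have h := congrArg (fun Q : Polynomial ℂ => Q.coeff k) hP
      simpa [Polynomial.coeff_map, Polynomial.coeff_X_pow, hk] using! h
  have hd : P.natDegree = Fintype.card K := by
    have h := congrArg Polynomial.natDegree hP
    rwa [(MulSemiringAction.monic_charpoly K f).natDegree_map, Polynomial.natDegree_X_pow] at h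
  have hl : P.coeff (Fintype.card K) = 1 := by
    rw [← hd]
    exact MulSemiringAction.monic_charpoly K f
  refine ⟨Fintype.card K, ?_⟩
  -- Solving P(f) = 0 for the leading term expresses f^|K| through coefficients in the ideal.
  have he : P.eval f = 0 := MulSemiringAction.eval_charpoly K f
  rw [Polynomial.eval_eq_sum_range, hd, Finset.sum_range_succ, hl, one_mul] at he
  rw [eq_neg_of_add_eq_zero_right he]
  exact neg_mem (sum_mem fun k hk =>
    Ideal.mul_mem_right _ _ (hmem k (Finset.mem_range.1 hk).ne))

theorem fg_ker_valueAtOne {ι : Type*} [Fintype ι] (c : ι → X.stalk 1)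
    (hc : ∀ i, X.valueAtOne (c i) = 0)
    (h : ∀ f, X.valueAtOne f = 0 → ∃ φ : ι → X.stalk 1, f = ∑ i, φ i * c i) :
    (RingHom.ker X.valueAtOne).FG := by
  have e : RingHom.ker X.valueAtOne = Ideal.span (Set.range c) := by
    refine le_antisymm (fun f hf => ?_) (Ideal.span_le.2 ?_)
    · obtain ⟨φ, rfl⟩ := h f hf
      exact sum_mem fun i _ => Ideal.mul_mem_left _ _ (Ideal.subset_span ⟨i, rfl⟩)
    · rintro _ ⟨i, rfl⟩
      exact hc i
  rw [e]
  exact Submodule.fg_span (Set.finite_range c)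

/-- Turns generic vanishing into a concrete dense open set, the form in which both faithfulness
proofs use it. -/
theorem restrictGeneric_eq_zero_iff {x : V} {f : V → ℂ} :
    X.restrictGeneric x (f : Germ (X.nhd x) ℂ) = 0 ↔
      ∃ D, IsOpen[X.top] D ∧ @Dense V X.top D ∧ ∀ᶠ y in X.nhd x, y ∈ D → f y = 0 := by
  refine Germ.coe_eq.trans ⟨fun h => ?_, ?_⟩
  · obtain ⟨s, ⟨D, hD, hD', hDs⟩, t, ht, hst⟩ := mem_inf_iff_superset.1 h
    exact ⟨D, hD, hD', mem_of_superset ht fun y hy hyD => hst ⟨hDs hyD, hy⟩⟩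
  · rintro ⟨D, hD, hD', h⟩
    exact mem_inf_iff_superset.2 ⟨D, ⟨D, hD, hD', subset_rfl⟩, _, h, fun y hy => hy.2 hy.1⟩

theorem finite_quotient_augmentationIdeal [Finite K] (hX : (RingHom.ker X.valueAtOne).FG) :
    Module.Finite ℂ (X.stalk 1 ⧸ X.augmentationIdeal K) :=
  finite_quotient_of_ker_le_radical X.valueAtOne hX augmentationIdeal_le_ker
    ker_le_radical_augmentationIdeal

end Codimension

/-! ### The proposition for a general geometric group -/

section Main

variable {G V : Type*} [Group G] [Finite G] [Group V] [MulDistribMulAction G V]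
  {X : GeometricGroup G V}

theorem mIsHarishChandra_of_preserves (hX : X.GenericallyFaithful)
    (hfg : (RingHom.ker X.valueAtOne).FG) {Γ : Subgroup V} (hΓ : ∀ g : G, ∀ ξ ∈ Γ, g • ξ ∈ Γ)
    (v : V) (H : Subgroup G) (A : Subalgebra ℂ (X.SkewRing Γ))
    (hG : Preserves A (⊤ : Subgroup G) (bigOrbit (⊤ : Subgroup G) Γ v))
    (hH : Preserves A H (bigOrbit H Γ v)) :
    MIsHarishChandra A (⊤ : Subgroup G) (bigOrbit (⊤ : Subgroup G) Γ v) ∧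
    MIsHarishChandra A (orbitStabilizer (⊤ : Subgroup G) Γ v) (smallOrbit Γ v) ∧
    MIsHarishChandra A H (bigOrbit H Γ v) ∧
    MIsHarishChandra A (orbitStabilizer H Γ v) (smallOrbit Γ v) ∧
    (Preserves A H (bigOrbit (⊤ : Subgroup G) Γ v) →
      MIsHarishChandra A H (bigOrbit (⊤ : Subgroup G) Γ v)) :=
  ⟨hG.mIsHarishChandra hX (finite_quotient_augmentationIdeal hfg)
      fun _ hg _ => smul_mem_bigOrbit hΓ hg,
    (hG.smallOrbit hΓ).mIsHarishChandra hX (finite_quotient_augmentationIdeal hfg)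
      fun _ hg _ => smul_mem_smallOrbit hg,
    hH.mIsHarishChandra hX (finite_quotient_augmentationIdeal hfg)
      fun _ hg _ => smul_mem_bigOrbit hΓ hg,
    (hH.smallOrbit hΓ).mIsHarishChandra hX (finite_quotient_augmentationIdeal hfg)
      fun _ hg _ => smul_mem_smallOrbit hg,
    fun h => h.mIsHarishChandra hX (finite_quotient_augmentationIdeal hfg)
      fun g _ _ => smul_mem_bigOrbit hΓ (Subgroup.mem_top g)⟩

end Main

end GeometricGroup

/-! ### Complex Lie groups: faithfulness and generators of the maximal ideal -/

section LieGroup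

/-- Hadamard's lemma for analytic functions. -/
theorem exists_analyticAt_eq_add_apply_sub {E : Type*} [NormedAddCommGroup E] [NormedSpace ℂ E]
    {f : E → ℂ} {x : E} (hf : AnalyticAt ℂ f x) :
    ∃ φ : E → E →L[ℂ] ℂ, AnalyticAt ℂ φ x ∧ ∀ᶠ y in 𝓝 x, f y = f x + φ y (y - x) := by
  obtain ⟨p, r, hp⟩ := hf
  -- The function φ is the sum of the shifted power series, in which one argument of each
  -- multilinear term is left free; its radius is that of p.
  have hr : 0 < p.shift.radius := by
    rw [FormalMultilinearSeries.radius_shift]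
    exact hp.r_pos.trans_le hp.r_le
  have hq := p.shift.hasFPowerSeriesOnBall hr
  have hq' := hq.comp_sub x
  rw [zero_add] at hq'
  refine ⟨_, hq'.analyticAt, ?_⟩
  filter_upwards [Metric.eball_mem_nhds x hp.r_pos, Metric.eball_mem_nhds x hr] with y hy hy'
  have h1 := hp.hasSum_sub hy
  have h2 := (ContinuousLinearMap.apply ℂ ℂ (y - x)).hasSum (hq'.hasSum_sub hy')
  have h3 := (hasSum_nat_add_iff' 1).2 h1
  have h4 := h3.unique (h2.congr_fun ?_)
  · rw [Finset.sum_range_one, hp.coeff_zero, sub_eq_iff_eq_add] at h4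
    rw [h4, add_comm]
    rfl
  -- Filling the free last slot with y - x restores the term of degree n + 1 of the series of f.
  · intro n
    refine congrArg (p (n + 1)) (funext fun i => ?_)
    refine Fin.lastCases ?_ (fun j => ?_) i
    · exact (Fin.snoc_last (α := fun _ => E) _ _).symm
    · exact (Fin.snoc_castSucc (α := fun _ => E) (y - x) (fun _ => y - x) j).symm

variable {V E : Type*} [NormedAddCommGroup E] [NormedSpace ℂ E] [TopologicalSpace V]
  [ChartedSpace E V] {G : Type*} [Group G] [Group V] [MulDistribMulAction G V]
  [LieGroup 𝓘(ℂ, E) ω V]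

/-- If f were nonzero at a point near x, continuity would make it nonzero on a neighbourhood, which
meets the dense set where f vanishes. -/
theorem complexLieGroup_genericallyFaithful
    (hG : ∀ g : G, ContMDiff 𝓘(ℂ, E) 𝓘(ℂ, E) ω (fun y : V => g • y)) :
    (complexLieGroup (E := E) hG).GenericallyFaithful := by
  rintro x _ ⟨f, rfl, hf⟩ h
  obtain ⟨D, -, hD, h⟩ := GeometricGroup.restrictGeneric_eq_zero_iff.1 h
  have h' : ∀ᶠ y in 𝓝 x, y ∈ D → f y = 0 := h
  refine Germ.coe_eq.2 (show ∀ᶠ y in 𝓝 x, f y = 0 from ?_)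
  filter_upwards [h'.eventually_nhds, hf] with y hy hfy
  by_contra hne
  have hD' : ∃ᶠ z in 𝓝 y, z ∈ D := mem_closure_iff_frequently.1 (hD y)
  obtain ⟨z, hz, h1, h2⟩ := (hD'.and_eventually
    (hy.and (hfy.continuousAt.eventually_ne hne))).exists
  exact h2 (h1 hz)

/-- In a chart around e, Hadamard's lemma and a basis of E write a germ vanishing at e as a
combination of the finitely many centred coordinates with holomorphic coefficients. -/
theorem fg_ker_valueAtOne_complexLieGroup [FiniteDimensional ℂ E]
    (hG : ∀ g : G, ContMDiff 𝓘(ℂ, E) 𝓘(ℂ, E) ω (fun y : V => g • y)) :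
    (RingHom.ker (complexLieGroup (E := E) hG).valueAtOne).FG := by
  have : IsManifold 𝓘(ℂ, E) ω V := ContMDiffMul.toIsManifold
  let e := extChartAt 𝓘(ℂ, E) (1 : V)
  let b := Module.finBasis ℂ E
  have he : ∀ᶠ y in 𝓝 (1 : V), ContMDiffAt 𝓘(ℂ, E) 𝓘(ℂ, E) ω e y := by
    filter_upwards [(chartAt E (1 : V)).open_source.mem_nhds (mem_chart_source E 1)] with y hy
    exact contMDiffAt_extChartAt' hy
  have hcomp : ∀ ψ : E → ℂ, AnalyticAt ℂ ψ (e 1) →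
      ((fun y => ψ (e y) : V → ℂ) : Germ (𝓝 (1 : V)) ℂ) ∈ holStalk E (1 : V) := by
    intro ψ hψ
    refine ⟨_, rfl, ?_⟩
    filter_upwards [he, he.self_of_nhds.continuousAt.eventually hψ.eventually_analyticAt]
      with y h1 h2
    exact (h2.contDiffAt.contMDiffAt).comp y h1
  have hb : ∀ i (z : E), AnalyticAt ℂ (fun z => b.coord i (z - e 1)) z := fun i z =>
    ((b.coord i).toContinuousLinearMap.analyticAt _).comp (analyticAt_id.sub analyticAt_const)
  refine GeometricGroup.fg_ker_valueAtOne (X := complexLieGroup (E := E) hG)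
    (fun i => ⟨_, hcomp _ (hb i _)⟩) (fun i => ?_) ?_
  · show b.coord i (e 1 - e 1) = 0
    simp
  · rintro ⟨_, f, rfl, hf⟩ (h0 : f 1 = 0)
    have hf1 := contMDiffAt_iff.1 hf.self_of_nhds
    have hfa : AnalyticAt ℂ (f ∘ e.symm) (e 1) := by
      have := hf1.2
      rw [ModelWithCorners.range_eq_univ, contDiffWithinAt_univ] at this
      exact this.analyticAt
    obtain ⟨φ, hφ, hφe⟩ := exists_analyticAt_eq_add_apply_sub hfa
    have hφi : ∀ i, AnalyticAt ℂ (fun z => φ z (b i)) (e 1) := fun i =>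
      ((ContinuousLinearMap.apply ℂ ℂ (b i)).analyticAt _).comp hφ
    refine ⟨fun i => ⟨_, hcomp _ (hφi i)⟩, Subtype.ext ?_⟩
    have hsum : ((fun y => ∑ i, φ (e y) (b i) * b.coord i (e y - e 1) : V → ℂ) :
        Germ (𝓝 (1 : V)) ℂ) = ∑ i, ((fun y => φ (e y) (b i) : V → ℂ) : Germ (𝓝 (1 : V)) ℂ) *
          ((fun y => b.coord i (e y - e 1) : V → ℂ) : Germ (𝓝 (1 : V)) ℂ) := by
      rw [← Finset.sum_fn]
      exact map_sum (Germ.coeRingHom (𝓝 (1 : V)))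
        (fun i y => φ (e y) (b i) * b.coord i (e y - e 1)) Finset.univ
    rw [AddSubmonoidClass.coe_finsetSum]
    refine Eq.trans (Germ.coe_eq.2 ?_) hsum
    have h1 : ∀ᶠ y in 𝓝 (1 : V), e.symm (e y) = y := by
      filter_upwards [extChartAt_source_mem_nhds (I := 𝓘(ℂ, E)) (1 : V)] with y hy
      exact e.left_inv hy
    filter_upwards [h1, he.self_of_nhds.continuousAt.eventually hφe] with y hy hy'
    rw [Function.comp_apply, Function.comp_apply, hy, h1.self_of_nhds, h0, zero_add] at hy'
    rw [hy']
    conv_lhs => rw [← b.sum_repr (e y - e 1), map_sum]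
    refine Finset.sum_congr rfl fun i _ => ?_
    rw [map_smul, smul_eq_mul, mul_comm]
    rfl

end LieGroup

/-! ### Linear algebraic groups: faithfulness and generators of the maximal ideal -/

section AlgebraicGroup

theorem sub_C_eval_mem_span {σ : Type*} (a : σ → ℂ) (p : MvPolynomial σ ℂ) :
    p - MvPolynomial.C (MvPolynomial.eval a p) ∈
      Ideal.span (Set.range fun i => MvPolynomial.X i - MvPolynomial.C (a i)) := by
  induction p using MvPolynomial.induction_on with
  | C r => simp
  | add p q hp hq =>
    convert! add_mem hp hq using 1
    rw [map_add, map_add]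
    ring
  | mul_X p i hp =>
    convert! add_mem (Ideal.mul_mem_right (MvPolynomial.X i) _ hp)
      (Ideal.mul_mem_left _ (MvPolynomial.C (MvPolynomial.eval a p))
        (Ideal.subset_span (Set.mem_range_self i))) using 1
    rw [map_mul, MvPolynomial.eval_X, map_mul]
    ring

variable {n : ℕ} {V : Subgroup (Matrix.GeneralLinearGroup (Fin n) ℂ)} {G : Type*} [Group G]
  [MulDistribMulAction G V]

/-- Write f = p/q on an open U. If f is nonzero at a point of U, the part of U where p is nonzero is
a nonempty Zariski open set, so it meets the dense set where f vanishes. -/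
theorem linearAlgebraicGroup_genericallyFaithful
    (hG : ∀ g : G, IsRegularMap V (fun y => g • y)) :
    (linearAlgebraicGroup hG).GenericallyFaithful := by
  rintro x _ ⟨f, rfl, p, q, hq, hf⟩ h
  obtain ⟨D, -, hD, h⟩ := GeometricGroup.restrictGeneric_eq_zero_iff.1 h
  let _ := zariski V
  have hD' : Dense D := hD
  have h' : ∀ᶠ y in 𝓝 x, y ∈ D → f y = 0 := h
  refine Germ.coe_eq.2 (show ∀ᶠ y in 𝓝 x, f y = 0 from ?_)
  obtain ⟨U, hU, hUo, hxU⟩ := eventually_nhds_iff.1 (h'.and (hf.and (eventually_evalAt V hq)))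
  refine eventually_nhds_iff.2 ⟨U, fun y hy => ?_, hUo, hxU⟩
  by_contra hne
  have hpy : evalAt V p y ≠ 0 := fun h0 => hne (by rw [(hU y hy).2.1, h0, zero_div])
  obtain ⟨z, ⟨hzU, hzp⟩, hzD⟩ := hD'.inter_open_nonempty _ (hUo.inter (isOpen_evalAt V p))
    ⟨y, hy, hpy⟩
  have hz := (hU z hzU).1 hzD
  rw [(hU z hzU).2.1] at hz
  exact div_ne_zero hzp (hU z hzU).2.2 hz

theorem evalAt_div_mem_regStalk (p : MvPolynomial (Fin n × Fin n) ℂ)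
    {q : MvPolynomial (Fin n × Fin n) ℂ} {x : V} (hq : evalAt V q x ≠ 0) :
    ((fun y => evalAt V p y / evalAt V q y : V → ℂ) : Germ (@nhds V (zariski V) x) ℂ) ∈
      regStalk V x :=
  ⟨_, rfl, p, q, hq, Eventually.of_forall fun _ => rfl⟩

/-- The generators are the matrix entries minus their values at the identity: a regular germ p/q
vanishing there has p(e) = 0, so p is a polynomial combination of them, and dividing the
coefficients by q finishes. -/
theorem fg_ker_valueAtOne_linearAlgebraicGroup
    (hG : ∀ g : G, IsRegularMap V (fun y => g • y)) :
    (RingHom.ker (linearAlgebraicGroup hG).valueAtOne).FG := by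
  let a : Fin n × Fin n → ℂ := fun ij => (1 : V).1.1 ij.1 ij.2
  let c : Fin n × Fin n → MvPolynomial (Fin n × Fin n) ℂ := fun ij =>
    MvPolynomial.X ij - MvPolynomial.C (a ij)
  have h1 : evalAt V 1 1 ≠ 0 := by simp [evalAt]
  refine GeometricGroup.fg_ker_valueAtOne (X := linearAlgebraicGroup hG)
    (fun ij => ⟨_, evalAt_div_mem_regStalk (c ij) h1⟩) (fun ij => ?_) ?_
  · show evalAt V (c ij) 1 / evalAt V 1 1 = 0
    simp [evalAt, c, a]
  · rintro ⟨_, f, rfl, p, q, hq, hf⟩ (h0 : f 1 = 0)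
    have hp : MvPolynomial.eval a p = 0 := by
      have h2 : f 1 = evalAt V p 1 / evalAt V q 1 :=
        @Eventually.self_of_nhds V (zariski V) 1 _ hf
      rw [h0, eq_comm, div_eq_zero_iff] at h2
      exact h2.resolve_right hq
    have hmem := sub_C_eval_mem_span a p
    rw [hp, map_zero, sub_zero] at hmem
    obtain ⟨φ, rfl⟩ := Ideal.mem_span_range_iff_exists_fun.1 hmem
    refine ⟨fun ij => ⟨_, evalAt_div_mem_regStalk (φ ij) hq⟩, Subtype.ext ?_⟩
    have hsum : ((fun y => ∑ ij, evalAt V (φ ij) y / evalAt V q y *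
        (evalAt V (c ij) y / evalAt V 1 y) : V → ℂ) : Germ (@nhds V (zariski V) 1) ℂ) =
        ∑ ij, ((fun y => evalAt V (φ ij) y / evalAt V q y : V → ℂ) :
          Germ (@nhds V (zariski V) 1) ℂ) *
          ((fun y => evalAt V (c ij) y / evalAt V 1 y : V → ℂ) :
            Germ (@nhds V (zariski V) 1) ℂ) := by
      rw [← Finset.sum_fn]
      exact map_sum (Germ.coeRingHom (@nhds V (zariski V) 1))
        (fun ij y => evalAt V (φ ij) y / evalAt V q y * (evalAt V (c ij) y / evalAt V 1 y))
        Finset.univ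
    rw [AddSubmonoidClass.coe_finsetSum]
    refine Eq.trans (Germ.coe_eq.2 ?_) hsum
    filter_upwards [hf] with y hy
    rw [hy]
    simp only [evalAt, map_sum, map_mul, map_one, div_one, Finset.sum_div, c]
    exact Finset.sum_congr rfl fun ij _ => by ring

end AlgebraicGroup

end HarishChandra

end

theorem mainTheorem5 {G : Type*} [Group G] [Finite G] :
    -- `V` is a complex Lie group
    (∀ {E V : Type*} [NormedAddCommGroup E] [NormedSpace ℂ E] [FiniteDimensional ℂ E]
        [TopologicalSpace V] [ChartedSpace E V] [Group V] [LieGroup 𝓘(ℂ, E) ω V]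
        [MulDistribMulAction G V]
        (hG : ∀ g : G, ContMDiff 𝓘(ℂ, E) 𝓘(ℂ, E) ω (fun y : V => g • y))
        (Γ : Subgroup V) (_ : ∀ g : G, ∀ ξ ∈ Γ, g • ξ ∈ Γ) (v : V) (H : Subgroup G)
        (A : Subalgebra ℂ ((complexLieGroup (E := E) hG).SkewRing Γ))
        (_ : Preserves A (⊤ : Subgroup G) (bigOrbit (⊤ : Subgroup G) Γ v))
        (_ : Preserves A H (bigOrbit H Γ v))
        (_ : (complexLieGroup (E := E) hG).invariantFunctions Γ ≤ A),
      MIsHarishChandra A (⊤ : Subgroup G) (bigOrbit (⊤ : Subgroup G) Γ v) ∧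
      MIsHarishChandra A (orbitStabilizer (⊤ : Subgroup G) Γ v) (smallOrbit Γ v) ∧
      MIsHarishChandra A H (bigOrbit H Γ v) ∧
      MIsHarishChandra A (orbitStabilizer H Γ v) (smallOrbit Γ v) ∧
      (Preserves A H (bigOrbit (⊤ : Subgroup G) Γ v) → MIsHarishChandra A H (bigOrbit (⊤ : Subgroup G) Γ v))) ∧
    -- `V` is a linear algebraic group
    (∀ {n : ℕ} (V : Subgroup (Matrix.GeneralLinearGroup (Fin n) ℂ)) (_ : IsZariskiClosed V)
        [MulDistribMulAction G V] (hG : ∀ g : G, IsRegularMap V (fun y => g • y))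
        (Γ : Subgroup V) (_ : ∀ g : G, ∀ ξ ∈ Γ, g • ξ ∈ Γ) (v : V) (H : Subgroup G)
        (A : Subalgebra ℂ ((linearAlgebraicGroup hG).SkewRing Γ))
        (_ : Preserves A (⊤ : Subgroup G) (bigOrbit (⊤ : Subgroup G) Γ v))
        (_ : Preserves A H (bigOrbit H Γ v))
        (_ : (linearAlgebraicGroup hG).invariantFunctions Γ ≤ A),
      MIsHarishChandra A (⊤ : Subgroup G) (bigOrbit (⊤ : Subgroup G) Γ v) ∧
      MIsHarishChandra A (orbitStabilizer (⊤ : Subgroup G) Γ v) (smallOrbit Γ v) ∧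
      MIsHarishChandra A H (bigOrbit H Γ v) ∧
      MIsHarishChandra A (orbitStabilizer H Γ v) (smallOrbit Γ v) ∧
      (Preserves A H (bigOrbit (⊤ : Subgroup G) Γ v) → MIsHarishChandra A H (bigOrbit (⊤ : Subgroup G) Γ v))) := by
  refine ⟨?_, ?_⟩
  · intro E V _ _ _ _ _ _ _ _ hG Γ hΓ v H A h1 h2 _
    exact mIsHarishChandra_of_preserves (complexLieGroup_genericallyFaithful hG)
      (fg_ker_valueAtOne_complexLieGroup hG) hΓ v H A h1 h2
  · intro n V _ _ hG Γ hΓ v H A h1 h2 _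
    exact mIsHarishChandra_of_preserves (linearAlgebraicGroup_genericallyFaithful hG)
      (fg_ker_valueAtOne_linearAlgebraicGroup hG) hΓ v H A h1 h2
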